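/- **Setting.** The cake is $[0,1]$. Each agent $i\in[n]$ has a piecewise constant density $f_i:[0,1]\to\mathbb R_{\ge0}$ with $\int_0^1 f_i>0$, and $v_i(S)=\int_S f_i(x)\,dx$. A bundle is a finite union of closed intervals of positive length; an allocation $A=(A_1,\dots,A_n)$ consists of bundles with pairwise null intersections (it need not exhaust the cake). It is MNW if it maximizes $(\prod_i v_i(A_i))^{1/n}$, and $\alpha$-MNW if $v_i(A_i)\ge\alpha\, v_i(A_i')$ for all $i$, for an MNW allocation $A'$. A (randomized) mechanism $M$ maps every reported profile, for every $n$, to a (random) allocation. It is $\alpha$-MNW if for every profile its realized allocation is almost surely $\alpha$-MNW, and deterministic if for every profile its allocation is almost surely a fixed one. Its incentive ratio is $$\sup_{n}\ \sup_{f_1,\dots,f_n}\ \sup_{i}\ \sup_{f_i'}\ \frac{\mathbb E[v_i(M_i(f_1,\dots,f_i',\dots,f_n))]}{\mathbb E[v_i(M_i(f_1,\dots,f_i,\dots,f_n))]}.$$ *Randomized PA mechanism with exponent $c$.* Compute an MNW allocation $A$ for the reported profile (ties are broken arbitrarily) and, for each $i$, an MNW allocation $A^i$ of the other agents. Put $$y_i=\left(\frac{\prod_{j\ne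 i}v_j(A_j)}{\prod_{j\ne i}v_j(A^i_j)}\right)^{c}.$$ Cut each $A_i$ into finitely many closed intervals with disjoint interiors such that all reported densities are constant in the interior of each. From each such interval $[\ell,r]$, agent $i$ receives the subinterval of length $y_i(r-\ell)$ starting at a point chosen independently and uniformly at random in $[\ell,r]$, where $[\ell,r]$ is treated as a cycle. **Theorem.** Let $c\in[0,1]$. 1. There is a mechanism whose incentive ratio is exactly $2^{1-c}$, which is $e^{-c}$-MNW, and which is deterministic if and only if $c=0$. 2. The randomized PA mechanism with exponent $c$ is realizable (MNW allocations cut as required exist for all profiles). For every choice of the MNW allocations and of their cuts, it has incentive ratio at most $2^{1-c}$, with equality if $c=0$ or $c=1$; it is $e^{-c}$-MNW; and it is deterministic if and only if $c=0$. -/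

import Mathlib

open MeasureTheory Set

noncomputable section

namespace Cake

/-- A value density function `f : [0,1] → ℝ≥0`: nonnegative, piecewise constant, and giving the
whole cake strictly positive value.  It is stored as a function on `ℝ` that vanishes off `[0,1]`.
Piecewise constant means: there is a finite set `B` of breakpoints such that `f` is constant on
every interval that contains no breakpoint. -/
structure Density where
  toFun : ℝ → ℝ
  nonneg : ∀ x, 0 ≤ toFun x
  zero_off : ∀ x, x ∉ Icc (0 : ℝ) 1 → toFun x = 0
  piecewise_const : ∃ B : Finset ℝ, ∀ x y, x ≤ y → (∀ b ∈ B, b ∉ Icc x y) → toFun x = toFun y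
  pos : 0 < ∫ x in Icc (0 : ℝ) 1, toFun x

/-- The value `v(S) = ∫_S f(x) dx` of a subset `S` of the cake. -/
def Density.value (f : Density) (S : Set ℝ) : ℝ := ∫ x in S, f.toFun x

/-- A bundle: a union of finitely many closed intervals of positive length inside `[0,1]`. -/
def IsBundle (S : Set ℝ) : Prop :=
  ∃ P : Finset (ℝ × ℝ), (∀ p ∈ P, 0 ≤ p.1 ∧ p.1 < p.2 ∧ p.2 ≤ 1) ∧ S = ⋃ p ∈ P, Icc p.1 p.2

/-- An allocation to the agents `ι` (with free disposal: the cake need not be exhausted). -/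
def IsAllocation {ι : Type} (A : ι → Set ℝ) : Prop :=
  (∀ i, IsBundle (A i)) ∧ ∀ i j, i ≠ j → volume (A i ∩ A j) = 0

/-- Nash welfare: the geometric mean of the agents' values. -/
def nashWelfare {ι : Type} [Fintype ι] (f : ι → Density) (A : ι → Set ℝ) : ℝ :=
  (∏ i, (f i).value (A i)) ^ (1 / (Fintype.card ι : ℝ))

/-- `A` is a maximum Nash welfare (MNW) allocation for the profile `f`. -/
def IsMNW {ι : Type} [Fintype ι] (f : ι → Density) (A : ι → Set ℝ) : Prop :=
  IsAllocation A ∧ ∀ A' : ι → Set ℝ, IsAllocation A' → nashWelfare f A' ≤ nashWelfare f A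

/-- `A` is `α`-approximate MNW: every agent gets at least an `α` fraction of what he gets in an
MNW allocation. -/
def IsApproxMNW {ι : Type} [Fintype ι] (α : ℝ) (f : ι → Density) (A : ι → Set ℝ) : Prop :=
  ∃ A' : ι → Set ℝ, IsMNW f A' ∧ ∀ i, α * (f i).value (A' i) ≤ (f i).value (A i)

/-- A (randomized) cake cutting mechanism, for every number `n` of agents: to each reported profile
it assigns a random allocation, given by a probability space and an allocation for every
sample point.  The value of each random bundle to each density is a random variable. -/
structure Mechanism where
  Ω : ∀ n : ℕ, (Fin n → Density) → Type
  mΩ : ∀ n f, MeasurableSpace (Ω n f)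
  μ : ∀ n f, @Measure (Ω n f) (mΩ n f)
  prob : ∀ n f, @IsProbabilityMeasure (Ω n f) (mΩ n f) (μ n f)
  outcome : ∀ n f, Ω n f → Fin n → Set ℝ
  isAllocation : ∀ n f ω, IsAllocation (outcome n f ω)
  measurable_value : ∀ n f i (g : Density),
    @Measurable _ _ (mΩ n f) _ fun ω => g.value (outcome n f ω i)

instance (M : Mechanism) (n : ℕ) (f : Fin n → Density) : MeasurableSpace (M.Ω n f) := M.mΩ n f

/-- The expected value, with respect to the density `g`, of the bundle that agent `i` receives when
the reported profile is `f`. -/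
def Mechanism.expectedValue (M : Mechanism) {n : ℕ} (f : Fin n → Density) (i : Fin n)
    (g : Density) : ℝ :=
  ∫ ω, g.value (M.outcome n f ω i) ∂(M.μ n f)

/-- The incentive ratio: the supremum over all numbers of agents, all (true) profiles `f`, all
agents `i` and all misreports `g` of agent `i`, of the expected utility of agent `i` when
misreporting divided by his expected utility when truthful. -/
def Mechanism.incentiveRatio (M : Mechanism) : ENNReal :=
  ⨆ (n : ℕ) (f : Fin n → Density) (i : Fin n) (g : Density),
    ENNReal.ofReal (M.expectedValue (Function.update f i g) i (f i)) /
      ENNReal.ofReal (M.expectedValue f i (f i))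

/-- The mechanism is `α`-MNW: its (realized) allocation is almost surely `α`-MNW. -/
def Mechanism.IsApproxMNW (M : Mechanism) (α : ℝ) : Prop :=
  ∀ (n : ℕ) (f : Fin n → Density), ∀ᵐ ω ∂(M.μ n f), Cake.IsApproxMNW α f (M.outcome n f ω)

/-- The mechanism is deterministic: for each profile its allocation is almost surely a fixed one. -/
def Mechanism.IsDeterministic (M : Mechanism) : Prop :=
  ∀ (n : ℕ) (f : Fin n → Density), ∃ A : Fin n → Set ℝ, ∀ᵐ ω ∂(M.μ n f), M.outcome n f ω = A

/-- The MNW allocations computed in the Partial Allocation mechanism, i.e. an arbitrary way of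
breaking ties.  For a profile `f`, the MNW allocation `A` is given by cutting each `A i` into
finitely many closed intervals `[p.1, p.2]` with disjoint interiors such that all the
reported densities are constant in the interior of each of them.  Moreover `absent f i` is an
MNW allocation for the agents other than `i`. -/
structure MNWRule where
  pieces : ∀ {n : ℕ}, (Fin n → Density) → Fin n → Finset (ℝ × ℝ)
  piece_mem : ∀ {n : ℕ} (f : Fin n → Density) (i : Fin n), ∀ p ∈ pieces f i,
    0 ≤ p.1 ∧ p.1 < p.2 ∧ p.2 ≤ 1
  piece_disjoint : ∀ {n : ℕ} (f : Fin n → Density) (i : Fin n), ∀ p ∈ pieces f i,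
    ∀ q ∈ pieces f i, p ≠ q → Disjoint (Ioo p.1 p.2) (Ioo q.1 q.2)
  piece_const : ∀ {n : ℕ} (f : Fin n → Density) (i : Fin n), ∀ p ∈ pieces f i,
    ∀ j, ∀ x ∈ Ioo p.1 p.2, ∀ y ∈ Ioo p.1 p.2, (f j).toFun x = (f j).toFun y
  isMNW : ∀ {n : ℕ} (f : Fin n → Density), IsMNW f fun i => ⋃ p ∈ pieces f i, Icc p.1 p.2
  absent : ∀ {n : ℕ}, (Fin n → Density) → (i : Fin n) → {j : Fin n // j ≠ i} → Set ℝ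
  absent_isMNW : ∀ {n : ℕ} (f : Fin n → Density) (i : Fin n),
    IsMNW (fun j : {j : Fin n // j ≠ i} => f j) (absent f i)

/-- The MNW allocation `A` selected by the rule. -/
def MNWRule.alloc (R : MNWRule) {n : ℕ} (f : Fin n → Density) (i : Fin n) : Set ℝ :=
  ⋃ p ∈ R.pieces f i, Icc p.1 p.2

/-- The fraction `y_i = (∏_{j ≠ i} v_j(A_j) / ∏_{j ≠ i} v_j(A^i_j)) ^ c` of his MNW bundle that
agent `i` keeps. -/
def MNWRule.fraction (R : MNWRule) (c : ℝ) {n : ℕ} (f : Fin n → Density) (i : Fin n) : ℝ :=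
  ((∏ j : {j : Fin n // j ≠ i}, (f j).value (R.alloc f j)) /
    (∏ j : {j : Fin n // j ≠ i}, (f j).value (R.absent f i j))) ^ c

/-- A closed interval, taken to be empty when it does not have positive length. -/
def seg (a b : ℝ) : Set ℝ := {x | a < b ∧ a ≤ x ∧ x ≤ b}

/-- The part of `[l, r]` that starts at `s ∈ [l, r]` and has length `L ≤ r - l`, where `[l, r]` is
treated as a cycle: `[s, s + L]` if this stays in `[l, r]`, and otherwise
`[s, r] ∪ [l, s + L - (r - l)]`. -/
def arc (l r s L : ℝ) : Set ℝ := seg s (min (s + L) r) ∪ seg l (min (s + L - (r - l)) r)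

/-- The bundle of agent `i` in the randomized Partial Allocation mechanism with exponent `c`: from
each piece `[l, r]` of his MNW bundle, he keeps the cyclic subinterval of length `y_i (r - l)`
that starts at `l + θ (r - l)`, where `θ ∈ [0,1]` is the random number drawn for the piece. -/
def MNWRule.outcome (R : MNWRule) (c : ℝ) {n : ℕ} (f : Fin n → Density)
    (θ : ((i : Fin n) × {p : ℝ × ℝ // p ∈ R.pieces f i}) → unitInterval) (i : Fin n) : Set ℝ :=
  ⋃ p : {p : ℝ × ℝ // p ∈ R.pieces f i},
    arc p.1.1 p.1.2 (p.1.1 + θ ⟨i, p⟩ * (p.1.2 - p.1.1)) (R.fraction c f i * (p.1.2 - p.1.1))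

theorem seg_isBundle {a b : ℝ} (ha : 0 ≤ a) (hb : b ≤ 1) : IsBundle (seg a b) := by
  by_cases h : a < b
  · refine ⟨{(a, b)}, ?_, ?_⟩
    · simp [ha, hb, h]
    · ext x; simp [seg, h]
  · refine ⟨∅, by simp, ?_⟩
    ext x; simp [seg, h]

theorem IsBundle.union {S T : Set ℝ} (hS : IsBundle S) (hT : IsBundle T) : IsBundle (S ∪ T) := by
  classical
  obtain ⟨P, hP, rfl⟩ := hS
  obtain ⟨Q, hQ, rfl⟩ := hT
  refine ⟨P ∪ Q, ?_, ?_⟩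
  · intro p hp
    rcases Finset.mem_union.1 hp with h | h
    exacts [hP p h, hQ p h]
  · rw [Finset.set_biUnion_union]

theorem IsBundle.iUnion {κ : Type} [Fintype κ] {S : κ → Set ℝ} (hS : ∀ k, IsBundle (S k)) :
    IsBundle (⋃ k, S k) := by
  classical
  choose P hP hSP using hS
  refine ⟨Finset.univ.biUnion P, ?_, ?_⟩
  · intro p hp
    obtain ⟨k, -, hk⟩ := Finset.mem_biUnion.1 hp
    exact hP k p hk
  · ext x
    simp only [mem_iUnion, Finset.mem_biUnion, Finset.mem_univ, true_and]
    constructor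
    · rintro ⟨k, hk⟩
      rw [hSP k] at hk
      simp only [mem_iUnion] at hk
      obtain ⟨p, hp, hx⟩ := hk
      exact ⟨p, ⟨k, hp⟩, hx⟩
    · rintro ⟨p, ⟨k, hp⟩, hx⟩
      refine ⟨k, ?_⟩
      rw [hSP k]
      simp only [mem_iUnion]
      exact ⟨p, hp, hx⟩

theorem arc_subset {l r s L : ℝ} (hs : s ∈ Icc l r) : arc l r s L ⊆ Icc l r := by
  rintro x (⟨-, h1, h2⟩ | ⟨-, h1, h2⟩)
  · exact ⟨hs.1.trans h1, h2.trans (min_le_right _ _)⟩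
  · exact ⟨h1, h2.trans (min_le_right _ _)⟩

theorem start_mem {l r : ℝ} (h : l < r) (θ : unitInterval) : l + θ * (r - l) ∈ Icc l r := by
  have h0 := θ.2.1
  have h1 := θ.2.2
  constructor <;> nlinarith

theorem MNWRule.outcome_subset (R : MNWRule) (c : ℝ) {n : ℕ} (f : Fin n → Density)
    (θ : ((i : Fin n) × {p : ℝ × ℝ // p ∈ R.pieces f i}) → unitInterval) (i : Fin n) :
    R.outcome c f θ i ⊆ R.alloc f i := by
  refine iUnion_subset fun p => ?_
  refine (arc_subset (start_mem (R.piece_mem f i p.1 p.2).2.1 _)).trans ?_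
  exact subset_biUnion_of_mem (u := fun p : ℝ × ℝ => Icc p.1 p.2) p.2

theorem MNWRule.outcome_isAllocation (R : MNWRule) (c : ℝ) {n : ℕ} (f : Fin n → Density)
    (θ : ((i : Fin n) × {p : ℝ × ℝ // p ∈ R.pieces f i}) → unitInterval) :
    IsAllocation (R.outcome c f θ) := by
  refine ⟨fun i => IsBundle.iUnion fun p => ?_, fun i j hij => ?_⟩
  · obtain ⟨h0, h1, h2⟩ := R.piece_mem f i p.1 p.2
    have hs := start_mem h1 (θ ⟨i, p⟩)
    exact (seg_isBundle (h0.trans hs.1) ((min_le_right _ _).trans h2)).union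
      (seg_isBundle h0 ((min_le_right _ _).trans h2))
  · exact measure_mono_null (inter_subset_inter (R.outcome_subset c f θ i)
      (R.outcome_subset c f θ j)) ((R.isMNW f).1.2 i j hij)

theorem Density.aestronglyMeasurable (g : Density) : AEStronglyMeasurable g.toFun volume := by
  obtain ⟨B, hB⟩ := g.piecewise_const
  have hopen : IsOpen ((B : Set ℝ)ᶜ) := B.finite_toSet.isClosed.isOpen_compl
  have hcont : ContinuousOn g.toFun ((B : Set ℝ)ᶜ) := by
    intro x hx
    refine ContinuousAt.continuousWithinAt ?_
    obtain ⟨ε, hε, hball⟩ := Metric.isOpen_iff.1 hopen x hx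
    have hev : g.toFun =ᶠ[nhds x] fun _ => g.toFun x := by
      filter_upwards [Metric.ball_mem_nhds x hε] with y hy
      have hconv : (Metric.ball x ε).OrdConnected := (convex_ball x ε).ordConnected
      rcases le_total x y with hxy | hxy
      · exact (hB x y hxy fun b hb hbm =>
          hball (hconv.out (Metric.mem_ball_self hε) hy hbm) hb).symm
      · exact hB y x hxy fun b hb hbm =>
          hball (hconv.out hy (Metric.mem_ball_self hε) hbm) hb
    exact continuousAt_const.congr hev.symm
  have h := hcont.aestronglyMeasurable (μ := volume) hopen.measurableSet
  have hae : ∀ᵐ x ∂(volume : Measure ℝ), x ∈ (B : Set ℝ)ᶜ := by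
    rw [ae_iff]
    simp only [mem_compl_iff, not_not]
    exact B.finite_toSet.measure_zero _
  rwa [Measure.restrict_eq_self_of_ae_mem hae] at h

theorem measurable_value_of_measurableSet {Ω : Type} [MeasurableSpace Ω] (g : Density)
    (S : Ω → Set ℝ) (hS : MeasurableSet {q : Ω × ℝ | q.2 ∈ S q.1}) :
    Measurable fun ω => g.value (S ω) := by
  have hg := g.aestronglyMeasurable
  have hSω : ∀ ω, MeasurableSet (S ω) := fun ω => measurable_prodMk_left hS
  have h1 : ∀ ω, g.value (S ω) =
      ∫ x, {q : Ω × ℝ | q.2 ∈ S q.1}.indicator (fun q => hg.mk _ q.2) (ω, x) := by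
    intro ω
    have h2 : g.value (S ω) = ∫ x in S ω, hg.mk _ x :=
      integral_congr_ae (ae_restrict_of_ae hg.ae_eq_mk)
    rw [h2, ← integral_indicator (hSω ω)]
    rfl
  simp only [h1]
  have h3 : StronglyMeasurable
      ({q : Ω × ℝ | q.2 ∈ S q.1}.indicator (fun q => hg.mk _ q.2)) :=
    (hg.stronglyMeasurable_mk.comp_measurable measurable_snd).indicator hS
  exact h3.integral_prod_right'.measurable

theorem measurableSet_seg {α : Type} [MeasurableSpace α] {a b x : α → ℝ} (ha : Measurable a)
    (hb : Measurable b) (hx : Measurable x) : MeasurableSet {q | x q ∈ seg (a q) (b q)} :=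
  (measurableSet_lt ha hb).inter ((measurableSet_le ha hx).inter (measurableSet_le hx hb))

theorem MNWRule.measurable_outcome (R : MNWRule) (c : ℝ) {n : ℕ} (f : Fin n → Density)
    (i : Fin n) (g : Density) : Measurable fun θ => g.value (R.outcome c f θ i) := by
  refine measurable_value_of_measurableSet g (fun θ => R.outcome c f θ i) ?_
  have h : {q : (((i : Fin n) × {p : ℝ × ℝ // p ∈ R.pieces f i}) → unitInterval) × ℝ |
      q.2 ∈ R.outcome c f q.1 i} = ⋃ p : {p : ℝ × ℝ // p ∈ R.pieces f i},
        {q | q.2 ∈ arc p.1.1 p.1.2 (p.1.1 + q.1 ⟨i, p⟩ * (p.1.2 - p.1.1))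
          (R.fraction c f i * (p.1.2 - p.1.1))} := by
    ext q; simp [MNWRule.outcome]
  rw [h]
  refine MeasurableSet.iUnion fun p => ?_
  refine MeasurableSet.union (measurableSet_seg ?_ ?_ ?_) (measurableSet_seg ?_ ?_ ?_) <;>
    fun_prop

/-- The randomized Partial Allocation mechanism with exponent `c`, built on the MNW allocations
selected by `R`.  The starting points in the different pieces are independent, and each is uniformly
distributed. -/
def MNWRule.randomizedPA (R : MNWRule) (c : ℝ) : Mechanism where
  Ω n f := ((i : Fin n) × {p : ℝ × ℝ // p ∈ R.pieces f i}) → unitInterval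
  mΩ _ _ := inferInstance
  μ _ _ := Measure.pi fun _ => volume
  prob _ _ := inferInstance
  outcome _ f θ := R.outcome c f θ
  isAllocation _ f θ := R.outcome_isAllocation c f θ
  measurable_value _ f i g := R.measurable_outcome c f i g

end Cake

end

/-!
Up to null sets, a profile of piecewise constant densities is a finite market of divisible goods:
the cells of a `Grid` on which all densities are constant are the goods, and every assignment of
fractions of the cells can be cut out of the cake (`Grid.alloc`, `Grid.value_alloc`).  So an MNW
allocation exists by compactness (`exists_isMNW_biUnion_Icc`), and every MNW allocation is an
optimal assignment of the market (`IsMNW.isOptimal`).  First-order optimality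
(`IsOptimal.sum_div_le`) says that the ratios of the values in another allocation to those in the
MNW allocation have sum at most the number of agents, and gives the prices of a Fisher market with
equal budgets (`IsOptimal.exists_price`).

Three facts about these allocations carry the theorem.

* A misreport at most doubles the value of an agent in the MNW allocation
  (`utility_le_two_mul`, `IsMNW.value_le_two_mul`), by a comparison of the prices with and without
  the misreport.
* With exponent `1`, the fraction `y` times the value of the agent is the Nash product of all
  agents divided by a number that he does not influence, so that truth-telling is optimal
  (`MNWRule.fraction_one_mul_value_le`).
* By first-order optimality, `y` is at least `exp (-1)` (`MNWRule.exp_neg_one_le_fraction_one`).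

A uniformly random cyclic subinterval contains an interior point of a piece with probability `y ^ c`.
Hence the expected value of agent `i` for any density is `y ^ c` times the value of his MNW bundle,
while his value for the reported density is exactly this number (`MNWRule.integral_value_arcs`,
`MNWRule.value_arcs`).  If `V`, `W` are the values of the MNW bundles of the agent with and without
truth-telling, and `y`, `y'` are the fractions, then
`y' ^ c * W = (y' * W) ^ c * W ^ (1 - c) ≤ (y * V) ^ c * (2 * V) ^ (1 - c)`,
which gives the bound `2 ^ (1 - c)`.  An outcome with `0 < y ^ c < 1` is not almost surely constant,
and two agents with equal densities have `y < 1` (`MNWRule.fraction_lt_one`).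

For `c = 0` the bound is attained in the limit by a family of profiles in which a misreport almost
doubles the value (`exists_lt_value`), and for `c = 1` by truthful reports.  For other exponents, a
mechanism with incentive ratio exactly `2 ^ (1 - c)` is obtained by lowering the fraction of one
agent in one profile of that family (`exists_mechanism_of_pos`).
-/

open MeasureTheory Set

noncomputable section

namespace Cake

/-! ### Markets of divisible goods -/

section

variable {ι κ : Type}

/-- A fractional assignment of the divisible goods `κ` to the agents `ι`: agent `j` receives the
fraction `x j k` of good `k`; part of a good may be left over. -/
def IsAssignment [Fintype ι] (x : ι → κ → ℝ) : Prop :=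
  (∀ j k, 0 ≤ x j k) ∧ ∀ k, ∑ j, x j k ≤ 1

/-- The linear utility of a share vector `x` for an agent who values the goods at `u`. -/
def utility [Fintype κ] (u x : κ → ℝ) : ℝ := ∑ k, x k * u k

/-- The fractional assignment `x` maximizes the product of the utilities. -/
def IsOptimal [Fintype ι] [Fintype κ] (u x : ι → κ → ℝ) : Prop :=
  IsAssignment x ∧ ∀ z : ι → κ → ℝ, IsAssignment z →
    ∏ j, utility (u j) (z j) ≤ ∏ j, utility (u j) (x j)

theorem IsAssignment.mix [Fintype ι] {x z : ι → κ → ℝ} (hx : IsAssignment x)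
    (hz : IsAssignment z) {ε : ℝ} (h0 : 0 ≤ ε) (h1 : ε ≤ 1) :
    IsAssignment fun j k => (1 - ε) * x j k + ε * z j k := by
  refine ⟨fun j k => ?_, fun k => ?_⟩
  · have := hx.1 j k
    have := hz.1 j k
    have : 0 ≤ 1 - ε := by linarith
    positivity
  · rw [Finset.sum_add_distrib, ← Finset.mul_sum, ← Finset.mul_sum]
    nlinarith [hx.2 k, hz.2 k]

theorem utility_mix [Fintype κ] (u x z : κ → ℝ) (ε : ℝ) :
    utility u (fun k => (1 - ε) * x k + ε * z k) = (1 - ε) * utility u x + ε * utility u z := by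
  simp only [utility, Finset.mul_sum, ← Finset.sum_add_distrib]
  exact Finset.sum_congr rfl fun k _ => by ring

/-- If moving from the point `1` in direction `d` never increases the product of the coordinates,
then `d` has nonpositive sum, which is the derivative of the product in this direction. -/
theorem sum_nonpos_of_prod_le_one [Fintype ι] (d : ι → ℝ)
    (h : ∀ ε ∈ Ioc (0 : ℝ) 1, ∏ j, (1 + ε * d j) ≤ 1) : ∑ j, d j ≤ 0 := by
  classical
  have hd : HasDerivAt (fun ε : ℝ => ∏ j, (1 + ε * d j)) (∑ j, d j) 0 := by
    have := HasDerivAt.fun_finsetProd (u := (Finset.univ : Finset ι))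
      (f := fun j (ε : ℝ) => 1 + ε * d j) (f' := d) (x := (0 : ℝ))
      fun j _ => by simpa using ((hasDerivAt_id (0 : ℝ)).mul_const (d j)).const_add 1
    simpa using this
  have hs := (hasDerivAt_iff_tendsto_slope.1 hd).mono_left
    (nhdsWithin_mono (0 : ℝ) (show Ioi (0 : ℝ) ⊆ {0}ᶜ from fun x hx => ne_of_gt hx))
  refine le_of_tendsto hs ?_
  filter_upwards [Ioc_mem_nhdsGT (zero_lt_one (α := ℝ))] with ε hε
  have := h ε hε
  simp only [slope_def_field, zero_mul, add_zero, Finset.prod_const_one, sub_zero]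
  exact div_nonpos_of_nonpos_of_nonneg (by linarith) hε.1.le

variable [Fintype ι] [Fintype κ]

/-- First-order optimality: the derivative of the logarithm of the product of the utilities in the
direction of another assignment `z` is not positive. -/
theorem IsOptimal.sum_div_le {u x z : ι → κ → ℝ} (hx : IsOptimal u x)
    (hpos : ∀ j, 0 < utility (u j) (x j)) (hz : IsAssignment z) :
    ∑ j, utility (u j) (z j) / utility (u j) (x j) ≤ Fintype.card ι := by
  have key := sum_nonpos_of_prod_le_one
    (fun j => utility (u j) (z j) / utility (u j) (x j) - 1) fun ε hε => by
      have h1 := hx.2 _ (hx.1.mix hz hε.1.le hε.2)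
      simp only [utility_mix] at h1
      have h2 : ∏ j, ((1 - ε) * utility (u j) (x j) + ε * utility (u j) (z j)) =
          (∏ j, (1 + ε * (utility (u j) (z j) / utility (u j) (x j) - 1))) *
            ∏ j, utility (u j) (x j) := by
        rw [← Finset.prod_mul_distrib]
        refine Finset.prod_congr rfl fun j _ => ?_
        have := (hpos j).ne'
        field_simp
        ring
      rw [h2] at h1
      have h3 : 0 < ∏ j, utility (u j) (x j) := Finset.prod_pos fun j _ => hpos j
      exact le_of_mul_le_mul_right (by simpa using h1) h3
  rw [Finset.sum_sub_distrib] at key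
  simp at key
  linarith

/-- Equilibrium prices of the Fisher market in which every agent has a budget of one unit of money:
no agent gets more utility per unit of money from a good than from his own share, goods are bought
only at the best rate, budgets are exhausted, and only free goods are left over. -/
structure IsEquilibriumPrice (u x : ι → κ → ℝ) (p : κ → ℝ) : Prop where
  nonneg : ∀ k, 0 ≤ p k
  le : ∀ j k, u j k / utility (u j) (x j) ≤ p k
  eq_of_share : ∀ j k, x j k ≠ 0 → p k = u j k / utility (u j) (x j)
  spend : ∀ j, ∑ k, x j k * p k = 1
  cleared : ∀ k, p k ≠ 0 → ∑ j, x j k = 1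

/-- An optimal assignment is a market equilibrium: the price of a good is the best rate
`u j k / utility (u j) (x j)` that some agent `j` offers for it. -/
theorem IsOptimal.exists_price [Nonempty ι] {u x : ι → κ → ℝ} (hx : IsOptimal u x)
    (hu : ∀ j k, 0 ≤ u j k) (hpos : ∀ j, 0 < utility (u j) (x j)) :
    ∃ p : κ → ℝ, IsEquilibriumPrice u x p := by
  classical
  have hex : ∀ k, ∃ j, ∀ i, u i k / utility (u i) (x i) ≤ u j k / utility (u j) (x j) :=
    fun k => Finite.exists_max fun j => u j k / utility (u j) (x j)
  choose b hb using hex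
  set V : ι → ℝ := fun j => utility (u j) (x j) with hV
  set p : κ → ℝ := fun k => u (b k) k / V (b k) with hp
  have hp0 : ∀ k, 0 ≤ p k := fun k => div_nonneg (hu _ _) (hpos _).le
  -- Giving every good to an agent who offers the best rate shows that the prices sum to at most
  -- the total budget.
  have hsum : ∑ k, p k ≤ Fintype.card ι := by
    have hz : IsAssignment fun j k => if b k = j then (1 : ℝ) else 0 :=
      ⟨fun j k => by positivity, fun k => by simp⟩
    have := hx.sum_div_le hpos hz
    refine le_trans (le_of_eq ?_) this
    simp only [utility, Finset.sum_div]
    rw [Finset.sum_comm]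
    refine Finset.sum_congr rfl fun k _ => ?_
    rw [Finset.sum_eq_single (b k)]
    · simp [hp, hV, utility]
    · intro j _ hj; simp [Ne.symm hj]
    · simp
  have hterm : ∀ j k, x j k * (u j k / V j) ≤ x j k * p k := fun j k =>
    mul_le_mul_of_nonneg_left (hb k j) (hx.1.1 j k)
  have hone : ∀ j, ∑ k, x j k * (u j k / V j) = 1 := fun j => by
    simp only [← mul_div_assoc, ← Finset.sum_div]
    exact div_self (hpos j).ne'
  have hge : ∀ j, 1 ≤ ∑ k, x j k * p k := fun j =>
    (hone j).symm.le.trans (Finset.sum_le_sum fun k _ => hterm j k)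
  have hswap : ∑ j, ∑ k, x j k * p k = ∑ k, (∑ j, x j k) * p k := by
    rw [Finset.sum_comm]
    simp only [Finset.sum_mul]
  have hle1 : ∀ k, (∑ j, x j k) * p k ≤ p k := fun k =>
    mul_le_of_le_one_left (hp0 k) (hx.1.2 k)
  have hcard : (Fintype.card ι : ℝ) = ∑ _j : ι, (1 : ℝ) := by simp
  have hall : ∑ j, ∑ k, x j k * p k ≤ ∑ _j : ι, (1 : ℝ) := by
    rw [hswap, ← hcard]
    exact (Finset.sum_le_sum fun k _ => hle1 k).trans hsum
  have hspend : ∀ j, ∑ k, x j k * p k = 1 := fun j =>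
    (((Finset.sum_eq_sum_iff_of_le fun j _ => hge j).1
      (le_antisymm (Finset.sum_le_sum fun j _ => hge j) hall)) j (Finset.mem_univ j)).symm
  refine ⟨p, hp0, fun j k => hb k j, fun j k hjk => ?_, hspend, fun k hk => ?_⟩
  · have := ((Finset.sum_eq_sum_iff_of_le fun k _ => hterm j k).1
      ((hone j).trans (hspend j).symm)) k (Finset.mem_univ k)
    exact (mul_left_cancel₀ hjk this).symm
  · have h1 : ∑ k, p k ≤ ∑ k, (∑ j, x j k) * p k := by
      rw [← hswap]
      simp only [hspend]
      rw [← hcard]; exact hsum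
    have := ((Finset.sum_eq_sum_iff_of_le fun k _ => hle1 k).1
      (le_antisymm (Finset.sum_le_sum fun k _ => hle1 k) h1)) k (Finset.mem_univ k)
    exact mul_right_cancel₀ hk (this.trans (one_mul _).symm)

theorem IsEquilibriumPrice.sum_eq_card {u x : ι → κ → ℝ} {p : κ → ℝ}
    (h : IsEquilibriumPrice u x p) : ∑ k, p k = Fintype.card ι := by
  have h1 : ∀ k, p k = ∑ j, x j k * p k := fun k => by
    rw [← Finset.sum_mul]
    by_cases hk : p k = 0
    · simp [hk]
    · rw [h.cleared k hk, one_mul]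
  rw [Finset.sum_congr rfl fun k _ => h1 k, Finset.sum_comm]
  simp [h.spend]

/-- A misreport at most doubles the utility of an agent in an optimal assignment.  At the truthful
prices `p`, the share that agent `i` obtains by misreporting costs at most `2`.  The goods whose
price does not exceed the price `p'` under the misreport cost him at most his budget at `p'`.  The
goods `k` with `p' k < p k` are bought, in the truthful equilibrium, by agent `i` and by the set `L`
of those agents whose utility increases, and in the other equilibrium the agents in `L` spend
their whole budgets on these goods; hence only goods worth one unit of money are left for `i`. -/
theorem utility_le_two_mul {u u' x x' : ι → κ → ℝ} (i : ι) (hx : IsOptimal u x)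
    (hx' : IsOptimal u' x') (hu : ∀ j k, 0 ≤ u j k) (hu' : ∀ j k, 0 ≤ u' j k)
    (heq : ∀ j, j ≠ i → u' j = u j) (hpos : ∀ j, 0 < utility (u j) (x j))
    (hpos' : ∀ j, 0 < utility (u' j) (x' j)) :
    utility (u i) (x' i) ≤ 2 * utility (u i) (x i) := by
  classical
  have : Nonempty ι := ⟨i⟩
  obtain ⟨p, hp⟩ := hx.exists_price hu hpos
  obtain ⟨p', hp'⟩ := hx'.exists_price hu' hpos'
  set R : Finset κ := Finset.univ.filter fun k => p' k < p k with hR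
  set L : Finset ι := Finset.univ.filter fun j =>
    j ≠ i ∧ utility (u j) (x j) < utility (u' j) (x' j) with hL
  have hcost : utility (u i) (x' i) ≤ utility (u i) (x i) * ∑ k, x' i k * p k := by
    rw [Finset.mul_sum]
    refine Finset.sum_le_sum fun k _ => ?_
    have h1 := (div_le_iff₀ (hpos i)).1 (hp.le i k)
    calc x' i k * u i k ≤ x' i k * (p k * utility (u i) (x i)) :=
          mul_le_mul_of_nonneg_left h1 (hx'.1.1 i k)
      _ = _ := by ring
  have hcheap : ∑ k ∈ Rᶜ, x' i k * p k ≤ 1 := by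
    rw [← hp'.spend i]
    calc ∑ k ∈ Rᶜ, x' i k * p k ≤ ∑ k ∈ Rᶜ, x' i k * p' k := by
          refine Finset.sum_le_sum fun k hk => mul_le_mul_of_nonneg_left ?_ (hx'.1.1 i k)
          simpa [hR] using hk
      _ ≤ _ := Finset.sum_le_sum_of_subset_of_nonneg (Finset.subset_univ _)
          fun k _ _ => mul_nonneg (hx'.1.1 i k) (hp'.nonneg k)
  have hiL : i ∉ L := by simp [hL]
  have hbuyers : ∑ k ∈ R, p k ≤ L.card + 1 := by
    have h1 : ∀ k ∈ R, p k = ∑ j ∈ insert i L, x j k * p k := fun k hk => by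
      have hk' : p' k < p k := by simpa [hR] using hk
      have h2 : ∑ j, x j k = 1 := hp.cleared k ((hp'.nonneg k).trans_lt hk').ne'
      rw [← Finset.sum_mul, Finset.sum_subset (Finset.subset_univ _), h2, one_mul]
      intro j _ hj
      by_contra hne
      have hji : j ≠ i := fun h => hj (h ▸ Finset.mem_insert_self _ _)
      have hle : utility (u' j) (x' j) ≤ utility (u j) (x j) := by
        by_contra hlt
        exact hj (Finset.mem_insert_of_mem (by simpa [hL, hji] using hlt))
      have h3 := hp'.le j k
      rw [heq j hji] at h3 hle
      have h4 : u j k / utility (u j) (x j) ≤ u j k / utility (u j) (x' j) :=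
        div_le_div_of_nonneg_left (hu j k) (heq j hji ▸ hpos' j) hle
      have h5 := hp.eq_of_share j k hne
      linarith
    rw [Finset.sum_congr rfl h1, Finset.sum_comm]
    calc ∑ j ∈ insert i L, ∑ k ∈ R, x j k * p k ≤ ∑ j ∈ insert i L, (1 : ℝ) := by
          refine Finset.sum_le_sum fun j _ => ?_
          rw [← hp.spend j]
          exact Finset.sum_le_sum_of_subset_of_nonneg (Finset.subset_univ _)
            fun k _ _ => mul_nonneg (hx.1.1 j k) (hp.nonneg k)
      _ = _ := by simp [Finset.card_insert_of_notMem hiL]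
  have hL1 : ∀ j ∈ L, 1 ≤ ∑ k ∈ R, x' j k * p k := fun j hj => by
    obtain ⟨hji, hlt⟩ : j ≠ i ∧ utility (u j) (x j) < utility (u' j) (x' j) := by
      simpa [hL] using hj
    calc (1 : ℝ) = ∑ k, x' j k * p' k := (hp'.spend j).symm
      _ = ∑ k ∈ R, x' j k * p' k := by
          refine (Finset.sum_subset (Finset.subset_univ _) fun k _ hk => ?_).symm
          have hk' : p k ≤ p' k := by simpa [hR] using hk
          by_cases hne : x' j k = 0
          · simp [hne]
          have h1 := hp'.eq_of_share j k hne
          have h2 := hp.le j k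
          rw [heq j hji] at h1 hlt
          rcases (hu j k).eq_or_lt with h0 | h0
          · simp [h1, ← h0]
          · have := div_lt_div_of_pos_left h0 (hpos j) hlt
            linarith
      _ ≤ ∑ k ∈ R, x' j k * p k := by
          refine Finset.sum_le_sum fun k hk => mul_le_mul_of_nonneg_left ?_ (hx'.1.1 j k)
          exact (show p' k < p k by simpa [hR] using hk).le
  have hdear : ∑ k ∈ R, x' i k * p k ≤ 1 := by
    have h1 : ∀ k ∈ R, x' i k * p k ≤ p k - ∑ j ∈ L, x' j k * p k := fun k _ => by
      have h2 : x' i k + ∑ j ∈ L, x' j k ≤ 1 := by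
        rw [← Finset.sum_insert hiL (f := fun j => x' j k)]
        exact (Finset.sum_le_sum_of_subset_of_nonneg (Finset.subset_univ _)
          fun j _ _ => hx'.1.1 j k).trans (hx'.1.2 k)
      rw [← Finset.sum_mul]
      nlinarith [hp.nonneg k]
    have h2 := Finset.sum_le_sum h1
    rw [Finset.sum_sub_distrib, Finset.sum_comm] at h2
    have h3 := Finset.sum_le_sum hL1
    simp only [Finset.sum_const, nsmul_eq_mul, mul_one] at h3
    linarith
  have hsplit := Finset.sum_add_sum_compl R fun k => x' i k * p k
  calc utility (u i) (x' i) ≤ utility (u i) (x i) * ∑ k, x' i k * p k := hcost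
    _ ≤ utility (u i) (x i) * 2 := mul_le_mul_of_nonneg_left (by linarith) (hpos i).le
    _ = _ := mul_comm _ _

/-- An optimal assignment exists, since the assignments form a compact set. -/
theorem exists_isOptimal (u : ι → κ → ℝ) : ∃ x : ι → κ → ℝ, IsOptimal u x := by
  classical
  set K : Set (ι → κ → ℝ) := {x | IsAssignment x} with hK
  have hclosed : IsClosed K := by
    have : K = (⋂ j, ⋂ k, {x : ι → κ → ℝ | 0 ≤ x j k}) ∩
        ⋂ k, {x : ι → κ → ℝ | ∑ j, x j k ≤ 1} := by
      ext x; simp [hK, IsAssignment]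
    rw [this]
    refine (isClosed_iInter fun j => isClosed_iInter fun k => ?_).inter
      (isClosed_iInter fun k => ?_)
    · exact isClosed_le continuous_const (by fun_prop)
    · exact isClosed_le (by fun_prop) continuous_const
  have hcpt : IsCompact K := by
    refine (isCompact_Icc (a := (0 : ι → κ → ℝ)) (b := 1)).of_isClosed_subset hclosed ?_
    intro x hx
    refine ⟨fun j k => hx.1 j k, fun j k => ?_⟩
    exact (Finset.single_le_sum (f := fun j => x j k) (fun j _ => hx.1 j k)
      (Finset.mem_univ j)).trans (hx.2 k)
  have hne : K.Nonempty := ⟨0, fun j k => le_rfl, fun k => by simp⟩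
  obtain ⟨x, hx, hmax⟩ := hcpt.exists_isMaxOn hne
    (f := fun x : ι → κ → ℝ => ∏ j, utility (u j) (x j))
    (by unfold utility; fun_prop)
  exact ⟨x, hx, fun z hz => hmax hz⟩

end

/-! ### Values of bundles -/

/-- A density is integrable, since otherwise its integral would have the junk value `0`. -/
theorem Density.integrable (g : Density) : Integrable g.toFun := by
  have h : IntegrableOn g.toFun (Icc 0 1) := by
    by_contra h
    exact g.pos.ne' (integral_undef h)
  refine h.integrable_of_forall_notMem_eq_zero fun x hx => g.zero_off x hx

theorem Density.value_nonneg (g : Density) (S : Set ℝ) : 0 ≤ g.value S :=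
  integral_nonneg fun x => g.nonneg x

theorem Density.value_congr (g : Density) {S T : Set ℝ} (h : S =ᵐ[volume] T) :
    g.value S = g.value T :=
  setIntegral_congr_set h

theorem IsBundle.measurableSet {S : Set ℝ} (h : IsBundle S) : MeasurableSet S := by
  obtain ⟨P, -, rfl⟩ := h
  exact Finset.measurableSet_biUnion _ fun _ _ => measurableSet_Icc

theorem isBundle_empty : IsBundle ∅ := ⟨∅, by simp, by simp⟩

theorem isBundle_biUnion_Icc {P : Finset (ℝ × ℝ)}
    (hP : ∀ p ∈ P, 0 ≤ p.1 ∧ p.1 < p.2 ∧ p.2 ≤ 1) : IsBundle (⋃ p ∈ P, Icc p.1 p.2) :=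
  ⟨P, hP, rfl⟩

theorem volume_Icc_inter_Icc {a b c d : ℝ} (h : Disjoint (Ioo a b) (Ioo c d)) :
    volume (Icc a b ∩ Icc c d) = 0 := by
  have : (Icc a b ∩ Icc c d : Set ℝ) =ᵐ[volume] (Ioo a b ∩ Ioo c d : Set ℝ) :=
    (Ioo_ae_eq_Icc.inter Ioo_ae_eq_Icc).symm
  rw [measure_congr this, h.inter_eq, measure_empty]

theorem Density.value_biUnion_Icc {α : Type} (g : Density) (s : Finset α) (a b : α → ℝ)
    (h : ∀ k ∈ s, ∀ l ∈ s, k ≠ l → Disjoint (Ioo (a k) (b k)) (Ioo (a l) (b l))) :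
    g.value (⋃ k ∈ s, Icc (a k) (b k)) = ∑ k ∈ s, g.value (Icc (a k) (b k)) := by
  have h1 : (⋃ k ∈ s, Icc (a k) (b k) : Set ℝ) =ᵐ[volume] (⋃ k ∈ s, Ioo (a k) (b k) : Set ℝ) :=
    Filter.EventuallyEq.countable_bUnion s.countable_toSet fun k _ => Ioo_ae_eq_Icc.symm
  rw [g.value_congr h1]
  have h2 := integral_biUnion_finset (μ := volume) (f := g.toFun) s
    (s := fun k => Ioo (a k) (b k)) (fun _ _ => measurableSet_Ioo)
    (fun k hk l hl hkl => h k hk l hl hkl) fun _ _ => g.integrable.integrableOn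
  refine h2.trans (Finset.sum_congr rfl fun k _ => ?_)
  exact g.value_congr Ioo_ae_eq_Icc

theorem Density.value_inter_Ioo (g : Density) {a b h : ℝ} {S : Set ℝ} (hS : MeasurableSet S)
    (hg : ∀ x ∈ Ioo a b, g.toFun x = h) :
    g.value (S ∩ Ioo a b) = volume.real (S ∩ Ioo a b) * h := by
  have : g.value (S ∩ Ioo a b) = ∫ _ in S ∩ Ioo a b, h :=
    setIntegral_congr_fun (hS.inter measurableSet_Ioo) fun x hx => hg x hx.2
  rw [this, setIntegral_const, smul_eq_mul]

theorem Density.value_Icc (g : Density) {a b h : ℝ} (hab : a ≤ b)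
    (hg : ∀ x ∈ Ioo a b, g.toFun x = h) : g.value (Icc a b) = (b - a) * h := by
  have := g.value_inter_Ioo (S := univ) MeasurableSet.univ hg
  rw [univ_inter, Real.volume_real_Ioo_of_le hab] at this
  rw [← this]
  exact g.value_congr Ioo_ae_eq_Icc.symm

/-! ### Grids -/

/-- A finite partition of the cake into intervals, up to a null set. -/
structure Grid (κ : Type) where
  left : κ → ℝ
  right : κ → ℝ
  left_nonneg : ∀ k, 0 ≤ left k
  lt : ∀ k, left k < right k
  right_le_one : ∀ k, right k ≤ 1
  disjoint : ∀ k l, k ≠ l → Disjoint (Ioo (left k) (right k)) (Ioo (left l) (right l))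
  cover : ∀ᵐ x : ℝ, x ∈ Icc (0 : ℝ) 1 → ∃ k, x ∈ Ioo (left k) (right k)

namespace Grid

variable {κ : Type} (G : Grid κ)

/-- The density `g` is constant in the interior of every cell of the grid. -/
def Adapted (g : Density) : Prop :=
  ∀ k, ∀ x ∈ Ioo (G.left k) (G.right k), ∀ y ∈ Ioo (G.left k) (G.right k), g.toFun x = g.toFun y

/-- The value of a whole cell. -/
def weight (g : Density) (k : κ) : ℝ := g.value (Icc (G.left k) (G.right k))

/-- The fraction of a cell that is covered by `S`. -/
def share (S : Set ℝ) (k : κ) : ℝ :=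
  volume.real (S ∩ Ioo (G.left k) (G.right k)) / (G.right k - G.left k)

theorem weight_nonneg (g : Density) (k : κ) : 0 ≤ G.weight g k := g.value_nonneg _

theorem Adapted.eq_weight_div {G : Grid κ} {g : Density} (h : G.Adapted g) (k : κ) :
    ∀ x ∈ Ioo (G.left k) (G.right k), g.toFun x = G.weight g k / (G.right k - G.left k) := by
  intro x hx
  have h1 := g.value_Icc (G.lt k).le fun y hy => h k y hy x hx
  have h2 := sub_pos.2 (G.lt k)
  rw [weight, h1]
  field_simp

theorem Adapted.value_eq [Fintype κ] {G : Grid κ} {g : Density} (h : G.Adapted g) {S : Set ℝ}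
    (hS : MeasurableSet S) : g.value S = utility (G.weight g) (G.share S) := by
  have h1 : g.value S = g.value (⋃ k ∈ Finset.univ, S ∩ Ioo (G.left k) (G.right k)) := by
    have hm : MeasurableSet (⋃ k ∈ (Finset.univ : Finset κ), S ∩ Ioo (G.left k) (G.right k)) :=
      Finset.measurableSet_biUnion _ fun _ _ => hS.inter measurableSet_Ioo
    simp only [Density.value]
    rw [← integral_indicator hS, ← integral_indicator hm]
    refine integral_congr_ae ?_
    filter_upwards [G.cover] with x hx
    by_cases hxS : x ∈ S
    · rw [indicator_of_mem hxS]
      by_cases hx1 : x ∈ Icc (0 : ℝ) 1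
      · obtain ⟨k, hk⟩ := hx hx1
        rw [indicator_of_mem]
        simp only [mem_iUnion]
        exact ⟨k, Finset.mem_univ k, hxS, hk⟩
      · rw [g.zero_off x hx1]
        simp [indicator, g.zero_off x hx1]
    · rw [indicator_of_notMem hxS, indicator_of_notMem]
      simp [hxS]
  have h2 := integral_biUnion_finset (μ := volume) (f := g.toFun) Finset.univ
    (s := fun k => S ∩ Ioo (G.left k) (G.right k)) (fun _ _ => hS.inter measurableSet_Ioo)
    (fun k _ l _ hkl => (G.disjoint k l hkl).mono inter_subset_right inter_subset_right)
    fun _ _ => g.integrable.integrableOn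
  rw [h1]
  refine h2.trans (Finset.sum_congr rfl fun k _ => ?_)
  have h3 := g.value_inter_Ioo hS (h.eq_weight_div k)
  rw [Density.value] at h3
  rw [h3, share]
  ring

theorem Adapted.sum_weight [Fintype κ] {G : Grid κ} {g : Density} (h : G.Adapted g) :
    ∑ k, G.weight g k = g.value (Icc 0 1) := by
  rw [h.value_eq measurableSet_Icc, utility]
  refine Finset.sum_congr rfl fun k _ => ?_
  have h1 : Icc (0 : ℝ) 1 ∩ Ioo (G.left k) (G.right k) = Ioo (G.left k) (G.right k) :=
    inter_eq_self_of_subset_right (Ioo_subset_Icc_self.trans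
      (Icc_subset_Icc (G.left_nonneg k) (G.right_le_one k)))
  rw [share, h1, Real.volume_real_Ioo_of_le (G.lt k).le, div_self (sub_pos.2 (G.lt k)).ne', one_mul]

theorem isAssignment_share {ι : Type} [Fintype ι] {A : ι → Set ℝ} (hA : IsAllocation A) :
    IsAssignment fun j => G.share (A j) := by
  refine ⟨fun j k => div_nonneg measureReal_nonneg (sub_pos.2 (G.lt k)).le, fun k => ?_⟩
  have hfin : ∀ j ∈ (Finset.univ : Finset ι), volume (A j ∩ Ioo (G.left k) (G.right k)) ≠ ⊤ :=
    fun j _ => ((measure_mono inter_subset_right).trans_lt (by simp)).ne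
  simp only [share]
  rw [← Finset.sum_div, div_le_one (sub_pos.2 (G.lt k)),
    ← Real.volume_real_Ioo_of_le (G.lt k).le,
    ← measureReal_biUnion_finset₀ (s := Finset.univ)
      (f := fun j => A j ∩ Ioo (G.left k) (G.right k)) (h := hfin)]
  · refine measureReal_mono ?_ (by simp)
    exact iUnion₂_subset fun j _ => inter_subset_right
  · intro i _ j _ hij
    exact measure_mono_null (inter_subset_inter inter_subset_left inter_subset_left) (hA.2 i j hij)
  · exact fun j _ => ((hA.1 j).measurableSet.inter measurableSet_Ioo).nullMeasurableSet

end Grid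

/-- The grid whose cells are the intervals between consecutive points of a finite set `B` that
contains the ends of the cake. -/
def Grid.ofFinset (B : Finset ℝ) (h0 : 0 ∈ B) (h1 : 1 ∈ B) (hB : ∀ b ∈ B, b ∈ Icc (0 : ℝ) 1) :
    Grid {p : ℝ × ℝ // p ∈ (B ×ˢ B).filter fun p => p.1 < p.2 ∧ ∀ b ∈ B, b ∉ Ioo p.1 p.2} where
  left p := p.1.1
  right p := p.1.2
  left_nonneg p := (hB _ (Finset.mem_product.1 (Finset.mem_filter.1 p.2).1).1).1
  lt p := (Finset.mem_filter.1 p.2).2.1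
  right_le_one p := (hB _ (Finset.mem_product.1 (Finset.mem_filter.1 p.2).1).2).2
  disjoint := by
    rintro ⟨p, hp⟩ ⟨q, hq⟩ hne
    rw [Finset.mem_filter, Finset.mem_product] at hp hq
    refine Set.disjoint_left.2 fun x hxp hxq => hne (Subtype.ext (Prod.ext ?_ ?_))
    · refine le_antisymm ?_ ?_ <;> by_contra! h
      · exact hq.2.2 _ hp.1.1 ⟨h, hxp.1.trans hxq.2⟩
      · exact hp.2.2 _ hq.1.1 ⟨h, hxq.1.trans hxp.2⟩
    · refine le_antisymm ?_ ?_ <;> by_contra! h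
      · exact hp.2.2 _ hq.1.2 ⟨hxp.1.trans hxq.2, h⟩
      · exact hq.2.2 _ hp.1.2 ⟨hxq.1.trans hxp.2, h⟩
  cover := by
    have hae : ∀ᵐ x : ℝ, x ∉ (B : Set ℝ) := measure_eq_zero_iff_ae_notMem.1
      (B.finite_toSet.measure_zero volume)
    filter_upwards [hae] with x hx hx01
    have hne : ∀ b ∈ B, b ≠ x := fun b hb h => hx (h ▸ hb)
    obtain ⟨a, ha, hamax⟩ := (B.filter (· < x)).exists_max_image id
      ⟨0, Finset.mem_filter.2 ⟨h0, lt_of_le_of_ne hx01.1 (hne 0 h0)⟩⟩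
    obtain ⟨b, hb, hbmin⟩ := (B.filter (x < ·)).exists_min_image id
      ⟨1, Finset.mem_filter.2 ⟨h1, lt_of_le_of_ne hx01.2 (hne 1 h1).symm⟩⟩
    rw [Finset.mem_filter] at ha hb
    refine ⟨⟨(a, b), Finset.mem_filter.2 ⟨Finset.mem_product.2 ⟨ha.1, hb.1⟩, ha.2.trans hb.2,
      fun c hc hcab => ?_⟩⟩, ha.2, hb.2⟩
    rcases lt_or_gt_of_ne (hne c hc) with h | h
    · exact absurd (hamax c (Finset.mem_filter.2 ⟨hc, h⟩)) (not_le.2 hcab.1)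
    · exact absurd (hbmin c (Finset.mem_filter.2 ⟨hc, h⟩)) (not_le.2 hcab.2)

theorem exists_grid {ι : Type} [Fintype ι] (f : ι → Density) :
    ∃ (κ : Type) (_ : Fintype κ) (G : Grid κ), ∀ j, G.Adapted (f j) := by
  classical
  choose b hb using fun j => (f j).piecewise_const
  set B : Finset ℝ := insert 0 (insert 1 ((Finset.univ.biUnion b).filter (· ∈ Icc (0 : ℝ) 1)))
    with hB
  have hB01 : ∀ x ∈ B, x ∈ Icc (0 : ℝ) 1 := by
    intro x hx
    simp only [hB, Finset.mem_insert, Finset.mem_filter] at hx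
    rcases hx with rfl | rfl | hx
    · simp
    · simp
    · exact hx.2
  refine ⟨_, inferInstance, Grid.ofFinset B (by simp [hB]) (by simp [hB]) hB01, fun j => ?_⟩
  have key : ∀ p : {p : ℝ × ℝ // p ∈ (B ×ˢ B).filter fun p => p.1 < p.2 ∧
      ∀ b ∈ B, b ∉ Ioo p.1 p.2}, ∀ x ∈ Ioo p.1.1 p.1.2, ∀ y ∈ Ioo p.1.1 p.1.2, x ≤ y →
      (f j).toFun x = (f j).toFun y := by
    rintro ⟨p, hp⟩ x hx y hy hxy
    rw [Finset.mem_filter, Finset.mem_product] at hp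
    refine hb j x y hxy fun c hc hcxy => ?_
    have hc' : c ∈ Ioo p.1 p.2 := ⟨hx.1.trans_le hcxy.1, hcxy.2.trans_lt hy.2⟩
    refine hp.2.2 c ?_ hc'
    have h1 := (hB01 _ hp.1.1).1
    have h2 := (hB01 _ hp.1.2).2
    simp only [hB, Finset.mem_insert, Finset.mem_filter, Finset.mem_biUnion]
    exact Or.inr (Or.inr ⟨⟨j, Finset.mem_univ j, hc⟩, h1.trans hc'.1.le, hc'.2.le.trans h2⟩)
  intro p x hx y hy
  rcases le_total x y with h | h
  · exact key p x hx y hy h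
  · exact (key p y hy x hx h).symm

/-! ### Realizing assignments as allocations -/

namespace Grid

variable {ι κ : Type} [Fintype ι] [LinearOrder ι] (G : Grid κ)

/-- The left end of the part of cell `k` that agent `j` receives when every cell is cut from left to
right in the order of the agents. -/
def cut (x : ι → κ → ℝ) (j : ι) (k : κ) : ℝ :=
  G.left k + (G.right k - G.left k) * ∑ i ∈ Finset.univ.filter (· < j), x i k

/-- The intervals that agent `j` receives when every cell is cut from left to right in the
proportions given by `x`. -/
def parts [Fintype κ] (x : ι → κ → ℝ) (j : ι) : Finset (ℝ × ℝ) := by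
  classical
  exact (Finset.univ.filter fun k => 0 < x j k).image fun k =>
    (G.cut x j k, G.cut x j k + (G.right k - G.left k) * x j k)

variable {G} {x : ι → κ → ℝ}

theorem left_le_cut (hx : IsAssignment x) (j : ι) (k : κ) : G.left k ≤ G.cut x j k := by
  have := Finset.sum_nonneg (s := Finset.univ.filter (· < j)) fun i _ => hx.1 i k
  have := mul_nonneg (sub_pos.2 (G.lt k)).le this
  rw [cut]
  linarith

theorem cut_add_le_right (hx : IsAssignment x) (j : ι) (k : κ) :
    G.cut x j k + (G.right k - G.left k) * x j k ≤ G.right k := by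
  have h1 : ∑ i ∈ insert j (Finset.univ.filter (· < j)), x i k ≤ 1 :=
    (Finset.sum_le_sum_of_subset_of_nonneg (Finset.subset_univ _)
      fun i _ _ => hx.1 i k).trans (hx.2 k)
  rw [Finset.sum_insert (by simp)] at h1
  have := mul_le_mul_of_nonneg_left h1 (sub_pos.2 (G.lt k)).le
  rw [cut]
  linarith

theorem cut_add_le_cut (hx : IsAssignment x) {i j : ι} (hij : i < j) (k : κ) :
    G.cut x i k + (G.right k - G.left k) * x i k ≤ G.cut x j k := by
  have h1 : ∑ l ∈ insert i (Finset.univ.filter (· < i)), x l k ≤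
      ∑ l ∈ Finset.univ.filter (· < j), x l k := by
    refine Finset.sum_le_sum_of_subset_of_nonneg (fun l hl => ?_) fun l _ _ => hx.1 l k
    rcases Finset.mem_insert.1 hl with rfl | hl
    · simpa using hij
    · exact Finset.mem_filter.2 ⟨Finset.mem_univ _, (Finset.mem_filter.1 hl).2.trans hij⟩
  rw [Finset.sum_insert (by simp)] at h1
  have := mul_le_mul_of_nonneg_left h1 (sub_pos.2 (G.lt k)).le
  simp only [cut]
  linarith

theorem Ioo_cut_subset (hx : IsAssignment x) (j : ι) (k : κ) :
    Ioo (G.cut x j k) (G.cut x j k + (G.right k - G.left k) * x j k) ⊆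
      Ioo (G.left k) (G.right k) :=
  Ioo_subset_Ioo (left_le_cut hx j k) (cut_add_le_right hx j k)

theorem disjoint_cut (hx : IsAssignment x) {i j : ι} {k l : κ} (h : i ≠ j ∨ k ≠ l) :
    Disjoint (Ioo (G.cut x i k) (G.cut x i k + (G.right k - G.left k) * x i k))
      (Ioo (G.cut x j l) (G.cut x j l + (G.right l - G.left l) * x j l)) := by
  by_cases hkl : k = l
  · subst hkl
    have hij : i ≠ j := h.resolve_right (by simp)
    refine Set.disjoint_left.2 fun y hy hy' => ?_
    rcases lt_or_gt_of_ne hij with hlt | hlt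
    · exact absurd ((hy.2.trans_le (cut_add_le_cut hx hlt k)).trans hy'.1) (lt_irrefl _)
    · exact absurd ((hy'.2.trans_le (cut_add_le_cut hx hlt k)).trans hy.1) (lt_irrefl _)
  · exact (G.disjoint k l hkl).mono (Ioo_cut_subset hx i k) (Ioo_cut_subset hx j l)

variable [Fintype κ]

theorem mem_parts {j : ι} {p : ℝ × ℝ} : p ∈ G.parts x j ↔ ∃ k, 0 < x j k ∧
    (G.cut x j k, G.cut x j k + (G.right k - G.left k) * x j k) = p := by
  simp [parts]

theorem parts_bounds (hx : IsAssignment x) {j : ι} {p : ℝ × ℝ} (hp : p ∈ G.parts x j) :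
    0 ≤ p.1 ∧ p.1 < p.2 ∧ p.2 ≤ 1 := by
  obtain ⟨k, hk, rfl⟩ := mem_parts.1 hp
  refine ⟨(G.left_nonneg k).trans (left_le_cut hx j k), ?_,
    (cut_add_le_right hx j k).trans (G.right_le_one k)⟩
  have := mul_pos (sub_pos.2 (G.lt k)) hk
  simpa using this

theorem parts_disjoint (hx : IsAssignment x) {i j : ι} {p q : ℝ × ℝ} (hp : p ∈ G.parts x i)
    (hq : q ∈ G.parts x j) (h : i ≠ j ∨ p ≠ q) : Disjoint (Ioo p.1 p.2) (Ioo q.1 q.2) := by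
  obtain ⟨k, hk, rfl⟩ := mem_parts.1 hp
  obtain ⟨l, hl, rfl⟩ := mem_parts.1 hq
  refine disjoint_cut hx ?_
  by_contra! hcon
  obtain ⟨rfl, rfl⟩ := hcon
  simp at h

theorem parts_const (hx : IsAssignment x) {g : Density} (hg : G.Adapted g) {j : ι} {p : ℝ × ℝ}
    (hp : p ∈ G.parts x j) : ∀ y ∈ Ioo p.1 p.2, ∀ z ∈ Ioo p.1 p.2, g.toFun y = g.toFun z := by
  obtain ⟨k, hk, rfl⟩ := mem_parts.1 hp
  exact fun y hy z hz => hg k y (Ioo_cut_subset hx j k hy) z (Ioo_cut_subset hx j k hz)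

variable (G x) in
/-- The allocation made of the intervals `parts`. -/
def alloc (j : ι) : Set ℝ := ⋃ p ∈ G.parts x j, Icc p.1 p.2

theorem isAllocation_alloc (hx : IsAssignment x) : IsAllocation (G.alloc x) := by
  refine ⟨fun j => isBundle_biUnion_Icc fun p hp => parts_bounds hx hp, fun i j hij => ?_⟩
  simp only [alloc, iUnion_inter, inter_iUnion]
  refine (measure_biUnion_null_iff (Finset.countable_toSet _)).2 fun q hq => ?_
  refine (measure_biUnion_null_iff (Finset.countable_toSet _)).2 fun p hp => ?_
  exact volume_Icc_inter_Icc (parts_disjoint hx hp hq (Or.inl hij))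

theorem value_alloc (hx : IsAssignment x) {g : Density} (hg : G.Adapted g) (j : ι) :
    g.value (G.alloc x j) = utility (G.weight g) (x j) := by
  classical
  have h1 : G.alloc x j = ⋃ k ∈ Finset.univ.filter fun k => 0 < x j k,
      Icc (G.cut x j k) (G.cut x j k + (G.right k - G.left k) * x j k) := by
    simp only [alloc, parts]
    rw [Finset.set_biUnion_finset_image]
  rw [h1, g.value_biUnion_Icc _ _ _ fun k _ l _ hkl => disjoint_cut hx (Or.inr hkl), utility,
    Finset.sum_filter]
  refine Finset.sum_congr rfl fun k _ => ?_
  have hpos := sub_pos.2 (G.lt k)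
  split_ifs with hk
  · rw [g.value_Icc (by have := mul_pos hpos hk; linarith)
      fun y hy => hg.eq_weight_div k y (Ioo_cut_subset hx j k hy)]
    field_simp
    ring
  · rw [le_antisymm (not_lt.1 hk) (hx.1 j k), zero_mul]

end Grid

/-! ### Maximum Nash welfare allocations -/

section

variable {ι : Type} [Fintype ι]

/-- The geometric mean in the definition of Nash welfare may be replaced by the product; this holds
also for the empty set of agents, where both are constant. -/
theorem isMNW_iff {f : ι → Density} {A : ι → Set ℝ} :
    IsMNW f A ↔ IsAllocation A ∧ ∀ B : ι → Set ℝ, IsAllocation B →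
      ∏ j, (f j).value (B j) ≤ ∏ j, (f j).value (A j) := by
  refine and_congr_right fun _ => forall_congr' fun B => imp_congr_right fun _ => ?_
  rcases isEmpty_or_nonempty ι with h | h
  · simp [nashWelfare]
  · exact Real.rpow_le_rpow_iff (Finset.prod_nonneg fun j _ => (f j).value_nonneg _)
      (Finset.prod_nonneg fun j _ => (f j).value_nonneg _)
      (one_div_pos.2 (Nat.cast_pos.2 Fintype.card_pos))

theorem IsMNW.prod_eq {f : ι → Density} {A B : ι → Set ℝ} (hA : IsMNW f A) (hB : IsMNW f B) :
    ∏ j, (f j).value (A j) = ∏ j, (f j).value (B j) :=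
  le_antisymm ((isMNW_iff.1 hB).2 A hA.1) ((isMNW_iff.1 hA).2 B hB.1)

variable [LinearOrder ι]

theorem IsMNW.value_pos {f : ι → Density} {A : ι → Set ℝ} (hA : IsMNW f A) (i : ι) :
    0 < (f i).value (A i) := by
  obtain ⟨κ, _, G, hG⟩ := exists_grid f
  have : Nonempty ι := ⟨i⟩
  have hcard : (0 : ℝ) < Fintype.card ι := Nat.cast_pos.2 Fintype.card_pos
  -- The equal split gives every agent a positive value.
  have hx : IsAssignment fun (_ : ι) (_ : κ) => (1 / Fintype.card ι : ℝ) :=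
    ⟨fun _ _ => by positivity, fun _ => by simp [hcard.ne']⟩
  have h1 := (isMNW_iff.1 hA).2 _ (Grid.isAllocation_alloc (G := G) hx)
  have h2 : 0 < ∏ j, (f j).value (G.alloc (fun (_ : ι) (_ : κ) => (1 / Fintype.card ι : ℝ)) j) := by
    refine Finset.prod_pos fun j _ => ?_
    rw [Grid.value_alloc hx (hG j), utility, ← Finset.mul_sum, (hG j).sum_weight]
    exact mul_pos (by positivity) (f j).pos
  refine lt_of_le_of_ne ((f i).value_nonneg _) fun h => ?_
  exact (h2.trans_le h1).ne' (Finset.prod_eq_zero (Finset.mem_univ i) h.symm)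

theorem IsMNW.isOptimal {κ : Type} [Fintype κ] {f : ι → Density} {A : ι → Set ℝ} (hA : IsMNW f A)
    {G : Grid κ} (hG : ∀ j, G.Adapted (f j)) :
    IsOptimal (fun j => G.weight (f j)) fun j => G.share (A j) := by
  refine ⟨G.isAssignment_share hA.1, fun z hz => ?_⟩
  have h := (isMNW_iff.1 hA).2 _ (Grid.isAllocation_alloc (G := G) hz)
  simpa only [Grid.value_alloc hz (hG _), (hG _).value_eq (hA.1.1 _).measurableSet] using h

/-- First-order optimality of a maximum Nash welfare allocation. -/
theorem IsMNW.sum_div_le {f : ι → Density} {A B : ι → Set ℝ} (hA : IsMNW f A)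
    (hB : IsAllocation B) :
    ∑ j, (f j).value (B j) / (f j).value (A j) ≤ Fintype.card ι := by
  obtain ⟨κ, _, G, hG⟩ := exists_grid f
  have h := (hA.isOptimal hG).sum_div_le
    (fun j => by rw [← (hG j).value_eq (hA.1.1 j).measurableSet]; exact hA.value_pos j)
    (G.isAssignment_share hB)
  simpa only [← (hG _).value_eq (hA.1.1 _).measurableSet,
    ← (hG _).value_eq (hB.1 _).measurableSet] using h

/-- For every choice of the two maximum Nash welfare allocations, a misreport at most doubles
the value of an agent. -/
theorem IsMNW.value_le_two_mul {f : ι → Density} {i : ι} {g : Density} {A B : ι → Set ℝ}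
    (hA : IsMNW f A) (hB : IsMNW (Function.update f i g) B) :
    (f i).value (B i) ≤ 2 * (f i).value (A i) := by
  obtain ⟨κ, _, G, hG⟩ := exists_grid fun o : Option ι => o.elim g f
  have hf : ∀ j, G.Adapted (f j) := fun j => hG (some j)
  have hg : ∀ j, G.Adapted (Function.update f i g j) := fun j => by
    rcases eq_or_ne j i with rfl | h
    · simpa using hG none
    · simpa [h] using hf j
  rw [(hf i).value_eq (hA.1.1 i).measurableSet, (hf i).value_eq (hB.1.1 i).measurableSet]
  refine utility_le_two_mul (u := fun j => G.weight (f j)) (x := fun j => G.share (A j))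
    (x' := fun j => G.share (B j)) i (hA.isOptimal hf) (hB.isOptimal hg)
    (fun j => G.weight_nonneg _) (fun j => G.weight_nonneg _) (fun j hj => by simp [hj])
    (fun j => ?_) fun j => ?_
  · rw [← (hf j).value_eq (hA.1.1 j).measurableSet]; exact hA.value_pos j
  · rw [← (hg j).value_eq (hB.1.1 j).measurableSet]; exact hB.value_pos j

theorem exists_isMNW_biUnion_Icc (f : ι → Density) : ∃ P : ι → Finset (ℝ × ℝ),
    (∀ i, ∀ p ∈ P i, 0 ≤ p.1 ∧ p.1 < p.2 ∧ p.2 ≤ 1) ∧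
    (∀ i, ∀ p ∈ P i, ∀ q ∈ P i, p ≠ q → Disjoint (Ioo p.1 p.2) (Ioo q.1 q.2)) ∧
    (∀ i, ∀ p ∈ P i, ∀ j, ∀ x ∈ Ioo p.1 p.2, ∀ y ∈ Ioo p.1 p.2,
      (f j).toFun x = (f j).toFun y) ∧
    IsMNW f fun i => ⋃ p ∈ P i, Icc p.1 p.2 := by
  obtain ⟨κ, _, G, hG⟩ := exists_grid f
  obtain ⟨x, hx, hmax⟩ := exists_isOptimal fun j => G.weight (f j)
  refine ⟨G.parts x, fun i p hp => Grid.parts_bounds hx hp,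
    fun i p hp q hq hpq => Grid.parts_disjoint hx hp hq (Or.inr hpq),
    fun i p hp j => Grid.parts_const hx (hG j) hp,
    isMNW_iff.2 ⟨Grid.isAllocation_alloc hx, fun B hB => ?_⟩⟩
  have h := hmax _ (G.isAssignment_share hB)
  simp only [← (hG _).value_eq (hB.1 _).measurableSet, ← Grid.value_alloc hx (hG _)] at h
  exact h

end

theorem nonempty_MNWRule : Nonempty MNWRule := by
  choose P h1 h2 h3 h4 using fun (n : ℕ) (f : Fin n → Density) => exists_isMNW_biUnion_Icc f
  choose Q k1 k2 k3 k4 using fun (n : ℕ) (f : Fin n → Density) (i : Fin n) =>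
    exists_isMNW_biUnion_Icc fun j : {j : Fin n // j ≠ i} => f j
  exact ⟨⟨fun {n} => P n, fun {n} => h1 n, fun {n} => h2 n, fun {n} => h3 n, fun {n} => h4 n,
    fun {n} f i j => ⋃ p ∈ Q n f i j, Icc p.1 p.2, fun {n} => k4 n⟩⟩

/-! ### The fractions of the Partial Allocation mechanism -/

namespace MNWRule

variable (R : MNWRule) {n : ℕ} (f : Fin n → Density) (i : Fin n)

theorem alloc_isMNW : IsMNW f (R.alloc f) := R.isMNW f

theorem value_alloc_pos : 0 < (f i).value (R.alloc f i) := (R.alloc_isMNW f).value_pos i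

theorem prod_alloc_pos :
    0 < ∏ j : {j : Fin n // j ≠ i}, (f j).value (R.alloc f j) :=
  Finset.prod_pos fun j _ => R.value_alloc_pos f j

theorem prod_absent_pos :
    0 < ∏ j : {j : Fin n // j ≠ i}, (f j).value (R.absent f i j) :=
  Finset.prod_pos fun j _ => (R.absent_isMNW f i).value_pos j

theorem fraction_one : R.fraction 1 f i =
    (∏ j : {j : Fin n // j ≠ i}, (f j).value (R.alloc f j)) /
      ∏ j : {j : Fin n // j ≠ i}, (f j).value (R.absent f i j) :=
  Real.rpow_one _

theorem fraction_eq_rpow (c : ℝ) : R.fraction c f i = R.fraction 1 f i ^ c := by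
  rw [fraction_one]; rfl

theorem fraction_one_pos : 0 < R.fraction 1 f i := by
  rw [fraction_one]
  exact div_pos (R.prod_alloc_pos f i) (R.prod_absent_pos f i)

theorem fraction_one_le_one : R.fraction 1 f i ≤ 1 := by
  rw [fraction_one, div_le_one (R.prod_absent_pos f i)]
  exact (isMNW_iff.1 (R.absent_isMNW f i)).2 (fun j => R.alloc f j)
    ⟨fun j => (R.alloc_isMNW f).1.1 j,
      fun j k hjk => (R.alloc_isMNW f).1.2 j k fun h => hjk (Subtype.ext h)⟩

/-- The allocation `absent f i`, which gives nothing to agent `i`, and first-order optimality of the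
allocation `alloc f` show that the ratios of the values of the other agents sum to at most `n`.
As there are `n - 1` of them, the inequality `q ≤ exp (q - 1)` bounds their product by `e`. -/
theorem exp_neg_one_le_fraction_one : Real.exp (-1) ≤ R.fraction 1 f i := by
  classical
  have hB : IsAllocation fun j => if h : j ≠ i then R.absent f i ⟨j, h⟩ else ∅ := by
    refine ⟨fun j => ?_, fun j k hjk => ?_⟩
    · dsimp only
      split_ifs
      · exact (R.absent_isMNW f i).1.1 _
      · exact isBundle_empty
    · dsimp only
      by_cases hj : j ≠ i
      · by_cases hk : k ≠ i
        · rw [dif_pos hj, dif_pos hk]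
          exact (R.absent_isMNW f i).1.2 _ _ fun h => hjk (Subtype.mk.inj h)
        · simp [hk]
      · simp [hj]
  have h1 := (R.alloc_isMNW f).sum_div_le hB
  rw [Fintype.sum_eq_add_sum_subtype_ne _ i] at h1
  have h2 : ∑ j : {j : Fin n // j ≠ i}, (f j).value (if h : (j : Fin n) ≠ i then
      R.absent f i ⟨j, h⟩ else ∅) / (f j).value (R.alloc f j) =
      ∑ j : {j : Fin n // j ≠ i}, (f j).value (R.absent f i j) / (f j).value (R.alloc f j) :=
    Finset.sum_congr rfl fun j _ => by rw [dif_pos j.2]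
  rw [h2] at h1
  simp only [ne_eq, not_true_eq_false, dite_false] at h1
  have h0 : (f i).value ∅ = 0 := by simp [Density.value]
  rw [h0, zero_div, zero_add] at h1
  set q : {j : Fin n // j ≠ i} → ℝ :=
    fun j => (f j).value (R.absent f i j) / (f j).value (R.alloc f j) with hq
  have hcard : (Fintype.card (Fin n) : ℝ) = 1 + ∑ _j : {j : Fin n // j ≠ i}, (1 : ℝ) := by
    rw [← Fintype.sum_eq_add_sum_subtype_ne (fun _ : Fin n => (1 : ℝ)) i]
    simp
  have h3 : ∏ j, q j ≤ Real.exp 1 := by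
    calc ∏ j, q j ≤ ∏ j, Real.exp (q j - 1) :=
          Finset.prod_le_prod (fun j _ => div_nonneg ((f j).value_nonneg _) ((f j).value_nonneg _))
            fun j _ => by linarith [Real.add_one_le_exp (q j - 1)]
      _ = Real.exp (∑ j, (q j - 1)) := (Real.exp_sum _ _).symm
      _ ≤ Real.exp 1 := by
          rw [Real.exp_le_exp, Finset.sum_sub_distrib]
          linarith
  have h4 : R.fraction 1 f i = (∏ j, q j)⁻¹ := by
    rw [fraction_one, hq, Finset.prod_div_distrib, inv_div]
  have h5 : 0 < ∏ j, q j := by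
    have := R.fraction_one_pos f i
    rw [h4] at this
    exact inv_pos.1 this
  rw [h4, Real.exp_neg]
  exact inv_anti₀ h5 h3

theorem fraction_pos (c : ℝ) : 0 < R.fraction c f i := by
  rw [fraction_eq_rpow]
  exact Real.rpow_pos_of_pos (R.fraction_one_pos f i) c

theorem fraction_le_one {c : ℝ} (hc : 0 ≤ c) : R.fraction c f i ≤ 1 := by
  rw [fraction_eq_rpow]
  exact Real.rpow_le_one (R.fraction_one_pos f i).le (R.fraction_one_le_one f i) hc

theorem exp_neg_le_fraction {c : ℝ} (hc : 0 ≤ c) : Real.exp (-c) ≤ R.fraction c f i := by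
  rw [fraction_eq_rpow]
  have h := Real.rpow_le_rpow (Real.exp_pos _).le (R.exp_neg_one_le_fraction_one f i) hc
  rwa [← Real.exp_mul, neg_one_mul] at h

/-- The Partial Allocation mechanism with exponent `1` is truthful: up to a factor that does not
depend on the report of agent `i`, his utility is the product of the values of all agents. -/
theorem fraction_one_mul_value_le (g : Density) :
    R.fraction 1 (Function.update f i g) i *
        (f i).value (R.alloc (Function.update f i g) i) ≤
      R.fraction 1 f i * (f i).value (R.alloc f i) := by
  have hu : ∀ j : {j : Fin n // j ≠ i}, Function.update f i g j = f j := fun j => by simp [j.2]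
  have hD := R.absent_isMNW (Function.update f i g) i
  simp only [hu] at hD
  have hD' := hD.prod_eq (R.absent_isMNW f i)
  simp only [fraction_one, hu]
  rw [hD', div_mul_eq_mul_div, div_mul_eq_mul_div, mul_comm _ ((f i).value _),
    mul_comm _ ((f i).value _),
    ← Fintype.prod_eq_mul_prod_subtype_ne
      (fun j => (f j).value (R.alloc (Function.update f i g) j)) i,
    ← Fintype.prod_eq_mul_prod_subtype_ne (fun j => (f j).value (R.alloc f j)) i]
  exact div_le_div_of_nonneg_right ((isMNW_iff.1 (R.alloc_isMNW f)).2 _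
    (R.alloc_isMNW (Function.update f i g)).1) (R.prod_absent_pos f i).le

/-- The bound on the gain from misreporting interpolates geometrically between the bound `2` for
exponent `0` and truthfulness for exponent `1`. -/
theorem fraction_mul_value_le {c : ℝ} (hc : c ∈ Icc (0 : ℝ) 1) (g : Density) :
    R.fraction c (Function.update f i g) i *
        (f i).value (R.alloc (Function.update f i g) i) ≤
      2 ^ (1 - c) * (R.fraction c f i * (f i).value (R.alloc f i)) := by
  have h1 := R.fraction_one_mul_value_le f i g
  have h2 := (R.alloc_isMNW f).value_le_two_mul (R.alloc_isMNW (Function.update f i g))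
  have hy := R.fraction_one_pos f i
  have hy' := R.fraction_one_pos (Function.update f i g) i
  have hV := R.value_alloc_pos f i
  rw [R.fraction_eq_rpow f, R.fraction_eq_rpow (Function.update f i g)]
  set y := R.fraction 1 f i
  set y' := R.fraction 1 (Function.update f i g) i
  set V := (f i).value (R.alloc f i)
  set W := (f i).value (R.alloc (Function.update f i g) i)
  have hW : 0 ≤ W := (f i).value_nonneg _
  have split : ∀ a b : ℝ, 0 ≤ a → 0 ≤ b → a ^ c * b = (a * b) ^ c * b ^ (1 - c) := by
    intro a b ha hb
    rw [Real.mul_rpow ha hb, mul_assoc, ← Real.rpow_add' hb (by norm_num)]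
    norm_num
  rw [split y' W hy'.le hW, split y V hy.le hV.le]
  calc (y' * W) ^ c * W ^ (1 - c) ≤ (y * V) ^ c * (2 * V) ^ (1 - c) :=
        mul_le_mul (Real.rpow_le_rpow (mul_nonneg hy'.le hW) h1 hc.1)
          (Real.rpow_le_rpow hW h2 (sub_nonneg.2 hc.2)) (by positivity) (by positivity)
    _ = _ := by rw [Real.mul_rpow (zero_le_two : (0 : ℝ) ≤ 2) hV.le]; ring

end MNWRule

/-! ### Random arcs -/

theorem measurableSet_arc {α : Type} [MeasurableSpace α] {l r L : ℝ} {s x : α → ℝ}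
    (hs : Measurable s) (hx : Measurable x) : MeasurableSet {q | x q ∈ arc l r (s q) L} :=
  (measurableSet_seg hs (by fun_prop) hx).union (measurableSet_seg (by fun_prop) (by fun_prop) hx)

theorem arc_full {l r s : ℝ} (hlr : l < r) (hs : s ∈ Icc l r) : arc l r s (r - l) = Icc l r := by
  refine (arc_subset hs).antisymm fun x hx => ?_
  have h1 : min (s + (r - l)) r = r := min_eq_right (by linarith [hs.1])
  have h2 : min (s + (r - l) - (r - l)) r = s := by rw [add_sub_cancel_right, min_eq_left hs.2]
  rw [arc, h1, h2]
  rcases hs.1.eq_or_lt with h | h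
  · exact Or.inl ⟨h ▸ hlr, h ▸ hx.1, hx.2⟩
  · rcases le_total x s with hxs | hxs
    · exact Or.inr ⟨h, hx.1, hxs⟩
    · rcases hs.2.eq_or_lt with h' | h'
      · exact Or.inr ⟨h, hx.1, h' ▸ hx.2⟩
      · exact Or.inl ⟨h', hxs, hx.2⟩

theorem seg_ae_eq_Ioo (a b : ℝ) : (seg a b : Set ℝ) =ᵐ[volume] (Ioo a b : Set ℝ) := by
  by_cases h : a < b
  · have : seg a b = Icc a b := by ext x; simp [seg, h]
    rw [this]
    exact Ioo_ae_eq_Icc.symm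
  · have : seg a b = ∅ := by ext x; simp [seg, h]
    rw [this, Ioo_eq_empty h]
    exact Filter.EventuallyEq.rfl

theorem volume_arc {l r s L : ℝ} (hs : s ∈ Icc l r) (hL0 : 0 ≤ L) (hL : L ≤ r - l) :
    volume.real (arc l r s L) = L := by
  have h : (arc l r s L : Set ℝ) =ᵐ[volume]
      (Ioo s (min (s + L) r) ∪ Ioo l (min (s + L - (r - l)) r) : Set ℝ) :=
    (seg_ae_eq_Ioo _ _).union (seg_ae_eq_Ioo _ _)
  have hmin : min (s + L - (r - l)) r = s + L - (r - l) := min_eq_left (by linarith [hs.2])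
  rw [measureReal_congr h, measureReal_union _ measurableSet_Ioo (by simp) (by simp),
    Real.volume_real_Ioo, Real.volume_real_Ioo, hmin]
  · rcases le_total (s + L) r with h1 | h1
    · rw [min_eq_left h1, max_eq_left (by linarith), max_eq_right (by linarith)]
      ring
    · rw [min_eq_right h1, max_eq_left (by linarith [hs.2]), max_eq_left (by linarith)]
      ring
  · refine Set.disjoint_left.2 fun x hx hx' => ?_
    have := hx.1
    have := hx'.2
    rw [hmin] at this
    linarith

/-- A uniformly random arc of length `φ (r - l)` contains every interior point of `[l, r]` with
probability `φ`. -/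
theorem volume_mem_arc {l r φ x : ℝ} (hφ0 : 0 ≤ φ) (hφ1 : φ ≤ 1) (hx : x ∈ Ioo l r) :
    (volume : Measure unitInterval).real
      {θ | x ∈ arc l r (l + θ * (r - l)) (φ * (r - l))} = φ := by
  have hlr : 0 < r - l := sub_pos.2 (hx.1.trans hx.2)
  obtain ⟨ξ, hξ⟩ : ∃ ξ, x = l + ξ * (r - l) := ⟨(x - l) / (r - l), by field_simp; ring⟩
  have hξ0 : 0 < ξ := by
    by_contra! h
    have := mul_nonpos_of_nonpos_of_nonneg h hlr.le
    linarith [hx.1]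
  have hξ1 : ξ < 1 := by
    by_contra! h
    have := le_mul_of_one_le_left hlr.le h
    linarith [hx.2]
  set S : Set ℝ := {t | x ∈ arc l r (l + t * (r - l)) (φ * (r - l))} with hS
  have hSm : MeasurableSet S := measurableSet_arc (by fun_prop) measurable_const
  have h1 : (volume : Measure unitInterval).real
      {θ | x ∈ arc l r (l + θ * (r - l)) (φ * (r - l))} = volume.real (S ∩ Icc 0 1) := by
    have hpre : {θ : unitInterval | x ∈ arc l r (l + θ * (r - l)) (φ * (r - l))} =
        ((↑) : unitInterval → ℝ) ⁻¹' S := rfl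
    rw [hpre, measureReal_def, measureReal_def,
      unitInterval.measurePreserving_coe.measure_preimage hSm.nullMeasurableSet,
      Measure.restrict_apply hSm]
  -- In the coordinates of the unit interval, the arc from `t` contains `ξ` if and only if `t` lies
  -- in `[ξ - φ, ξ]`, read cyclically.
  have h2 : (S ∩ Icc 0 1 : Set ℝ) =ᵐ[volume]
      (Ioo (max (ξ - φ) 0) ξ ∪ Ioo (ξ - φ + 1) 1 : Set ℝ) := by
    have hae : ∀ᵐ t : ℝ, t ∉ ({0, 1, ξ, ξ - φ, ξ - φ + 1} : Set ℝ) :=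
      measure_eq_zero_iff_ae_notMem.1 ((Set.toFinite _).measure_zero volume)
    filter_upwards [hae] with t ht
    simp only [mem_insert_iff, mem_singleton_iff, not_or] at ht
    obtain ⟨t0, t1, t2, t3, t4⟩ := ht
    have scale : ∀ a b : ℝ, l + a * (r - l) ≤ l + b * (r - l) ↔ a ≤ b := fun a b => by
      rw [add_le_add_iff_left, mul_le_mul_iff_left₀ hlr]
    have scale' : ∀ a b : ℝ, l + a * (r - l) < l + b * (r - l) ↔ a < b := fun a b => by
      rw [add_lt_add_iff_left, mul_lt_mul_iff_left₀ hlr]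
    have e1 : l + t * (r - l) + φ * (r - l) = l + (t + φ) * (r - l) := by ring
    have e2 : l + (t + φ) * (r - l) - (r - l) = l + (t + φ - 1) * (r - l) := by ring
    have e3 : l = l + 0 * (r - l) := by ring
    have e4 : r = l + 1 * (r - l) := by ring
    refine propext ?_
    change t ∈ S ∩ Icc 0 1 ↔ t ∈ Ioo (max (ξ - φ) 0) ξ ∪ Ioo (ξ - φ + 1) 1
    have hmem : t ∈ S ↔ ((t < t + φ ∧ t < 1) ∧ t ≤ ξ ∧ ξ ≤ t + φ ∧ ξ ≤ 1) ∨
        ((0 < t + φ - 1 ∧ (0 : ℝ) < 1) ∧ 0 ≤ ξ ∧ ξ ≤ t + φ - 1 ∧ ξ ≤ 1) := by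
      have a1 := scale' t (t + φ)
      have a2 := scale' t 1
      have a3 := scale t ξ
      have a4 := scale ξ (t + φ)
      have a5 := scale ξ 1
      have a6 := scale' 0 (t + φ - 1)
      have a7 := scale' 0 1
      have a8 := scale 0 ξ
      have a9 := scale ξ (t + φ - 1)
      rw [← e4] at a2 a5 a7
      rw [← e3] at a6 a7 a8
      simp only [hS, mem_ofPred_eq, arc, seg, mem_union, e1, e2, hξ, lt_min_iff, le_min_iff, a1, a2,
        a3, a4, a5, a6, a7, a8, a9]
    rw [mem_inter_iff, hmem]
    simp only [mem_union, mem_Ioo, mem_Icc, max_lt_iff]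
    constructor
    · rintro ⟨⟨⟨h1, h2⟩, h3, h4, h5⟩ | ⟨⟨h1, -⟩, h3, h4, h5⟩, h6, h7⟩
      · exact Or.inl ⟨⟨lt_of_le_of_ne (by linarith) (Ne.symm t3), lt_of_le_of_ne h6 (Ne.symm t0)⟩,
          lt_of_le_of_ne h3 t2⟩
      · exact Or.inr ⟨lt_of_le_of_ne (by linarith) (Ne.symm t4), lt_of_le_of_ne h7 t1⟩
    · rintro (⟨⟨h1, h2⟩, h3⟩ | ⟨h1, h2⟩)
      · exact ⟨Or.inl ⟨⟨by linarith, by linarith⟩, h3.le, by linarith, hξ1.le⟩, h2.le,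
          by linarith⟩
      · exact ⟨Or.inr ⟨⟨by linarith, one_pos⟩, hξ0.le, by linarith, hξ1.le⟩, by linarith, h2.le⟩
  have hdisj : Disjoint (Ioo (max (ξ - φ) 0) ξ) (Ioo (ξ - φ + 1) 1) :=
    Set.disjoint_left.2 fun t ht ht' => by linarith [ht.2, ht'.1]
  rw [h1, measureReal_congr h2, measureReal_union hdisj measurableSet_Ioo (by simp) (by simp),
    Real.volume_real_Ioo, Real.volume_real_Ioo]
  rcases le_total (ξ - φ) 0 with h | h
  · rw [max_eq_right h, max_eq_left (by linarith), max_eq_left (by linarith)]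
    ring
  · rw [max_eq_left h, max_eq_left (by linarith), max_eq_right (by linarith)]
    ring

/-- The expected value of a random set weights the density with the probability that the set
contains the point. -/
theorem integral_value {Ω : Type} [MeasurableSpace Ω] (μ : Measure Ω) [IsProbabilityMeasure μ]
    (g : Density) (S : Ω → Set ℝ) (hS : MeasurableSet {q : Ω × ℝ | q.2 ∈ S q.1}) :
    ∫ ω, g.value (S ω) ∂μ = ∫ x, μ.real {ω | x ∈ S ω} * g.toFun x := by
  have hSω : ∀ ω, MeasurableSet (S ω) := fun ω => measurable_prodMk_left hS
  have h1 : ∀ ω, g.value (S ω) =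
      ∫ x, {q : Ω × ℝ | q.2 ∈ S q.1}.indicator (fun q => g.toFun q.2) (ω, x) := by
    intro ω
    rw [Density.value, ← integral_indicator (hSω ω)]
    rfl
  simp only [h1]
  have hint : Integrable (Function.uncurry fun (ω : Ω) (x : ℝ) =>
      {q : Ω × ℝ | q.2 ∈ S q.1}.indicator (fun q => g.toFun q.2) (ω, x)) (μ.prod volume) :=
    (g.integrable.comp_snd μ).indicator hS
  rw [integral_integral_swap hint]
  refine integral_congr_ae (Filter.Eventually.of_forall fun x => ?_)
  have h2 : ∀ ω, {q : Ω × ℝ | q.2 ∈ S q.1}.indicator (fun q => g.toFun q.2) (ω, x) =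
      {ω | x ∈ S ω}.indicator (fun _ => g.toFun x) ω := fun ω => rfl
  simp only [h2]
  have h3 : MeasurableSet {ω | x ∈ S ω} := measurable_prodMk_right hS
  rw [integral_indicator_const _ h3, smul_eq_mul]

/-! ### Partial allocation with arbitrary fractions -/

namespace MNWRule

variable (R : MNWRule)

theorem mem_Icc_piece_iff {n : ℕ} {f : Fin n → Density} {i : Fin n} {p q : ℝ × ℝ}
    (hp : p ∈ R.pieces f i) (hq : q ∈ R.pieces f i) {x : ℝ} (hx : x ∈ Ioo p.1 p.2)
    (hxq : x ∈ Icc q.1 q.2) : q = p := by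
  by_contra hne
  have h := (R.piece_disjoint f i p hp q hq (Ne.symm hne)).closure_right isOpen_Ioo
  rw [closure_Ioo (R.piece_mem f i q hq).2.1.ne] at h
  exact Set.disjoint_left.1 h hx hxq

/-- The set of all random starting points for the pieces of the profile `f`. -/
abbrev Starts {n : ℕ} (f : Fin n → Density) : Type :=
  ((i : Fin n) × {p : ℝ × ℝ // p ∈ R.pieces f i}) → unitInterval

/-- The union of the arcs that agent `i` receives from his pieces if he keeps the fraction `φ` of
each. -/
def arcs (φ : ℝ) {n : ℕ} (f : Fin n → Density) (i : Fin n) (θ : R.Starts f) : Set ℝ :=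
  ⋃ p : {p : ℝ × ℝ // p ∈ R.pieces f i},
    arc p.1.1 p.1.2 (p.1.1 + θ ⟨i, p⟩ * (p.1.2 - p.1.1)) (φ * (p.1.2 - p.1.1))

variable {n : ℕ} (f : Fin n → Density) (i : Fin n)

theorem arcs_subset (φ : ℝ) (θ : R.Starts f) : R.arcs φ f i θ ⊆ R.alloc f i := by
  refine iUnion_subset fun p => ?_
  refine (arc_subset (start_mem (R.piece_mem f i p.1 p.2).2.1 _)).trans ?_
  exact subset_biUnion_of_mem (u := fun p : ℝ × ℝ => Icc p.1 p.2) p.2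

theorem isBundle_arcs (φ : ℝ) (θ : R.Starts f) : IsBundle (R.arcs φ f i θ) := by
  refine IsBundle.iUnion fun p => ?_
  obtain ⟨h0, h1, h2⟩ := R.piece_mem f i p.1 p.2
  have hs := start_mem h1 (θ ⟨i, p⟩)
  exact (seg_isBundle (h0.trans hs.1) ((min_le_right _ _).trans h2)).union
    (seg_isBundle h0 ((min_le_right _ _).trans h2))

theorem measurableSet_mem_arcs (φ : ℝ) :
    MeasurableSet {q : R.Starts f × ℝ | q.2 ∈ R.arcs φ f i q.1} := by
  have h : {q : R.Starts f × ℝ | q.2 ∈ R.arcs φ f i q.1} =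
      ⋃ p : {p : ℝ × ℝ // p ∈ R.pieces f i}, {q | q.2 ∈ arc p.1.1 p.1.2
        (p.1.1 + q.1 ⟨i, p⟩ * (p.1.2 - p.1.1)) (φ * (p.1.2 - p.1.1))} := by
    ext q; simp [arcs]
  rw [h]
  exact MeasurableSet.iUnion fun p => measurableSet_arc (by fun_prop) (by fun_prop)

theorem arcs_one (θ : R.Starts f) : R.arcs 1 f i θ = R.alloc f i := by
  refine (R.arcs_subset f i 1 θ).antisymm (iUnion₂_subset fun p hp => ?_)
  have h1 := (R.piece_mem f i p hp).2.1
  rw [← arc_full h1 (start_mem h1 (θ ⟨i, ⟨p, hp⟩⟩))]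
  refine subset_iUnion_of_subset ⟨p, hp⟩ ?_
  rw [one_mul]

theorem mem_arcs_iff (φ : ℝ) {p : ℝ × ℝ} (hp : p ∈ R.pieces f i) {x : ℝ} (hx : x ∈ Ioo p.1 p.2)
    (θ : R.Starts f) : x ∈ R.arcs φ f i θ ↔
      x ∈ arc p.1 p.2 (p.1 + θ ⟨i, ⟨p, hp⟩⟩ * (p.2 - p.1)) (φ * (p.2 - p.1)) := by
  refine mem_iUnion.trans ⟨?_, fun h => ⟨⟨p, hp⟩, h⟩⟩
  rintro ⟨⟨q, hq⟩, h⟩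
  have hxq := arc_subset (start_mem (R.piece_mem f i q hq).2.1 _) h
  obtain rfl := R.mem_Icc_piece_iff hp hq hx hxq
  exact h

theorem prob_mem_arcs {φ : ℝ} (hφ0 : 0 ≤ φ) (hφ1 : φ ≤ 1) {p : ℝ × ℝ} (hp : p ∈ R.pieces f i)
    {x : ℝ} (hx : x ∈ Ioo p.1 p.2) :
    (Measure.pi fun _ => volume : Measure (R.Starts f)).real {θ | x ∈ R.arcs φ f i θ} = φ := by
  simp only [R.mem_arcs_iff f i φ hp hx]
  refine Eq.trans ?_ (volume_mem_arc hφ0 hφ1 hx)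
  have h := measurePreserving_eval
    (fun _ : (i : Fin n) × {p : ℝ × ℝ // p ∈ R.pieces f i} => (volume : Measure unitInterval))
    ⟨i, ⟨p, hp⟩⟩
  have hm : MeasurableSet {t : unitInterval |
      x ∈ arc p.1 p.2 (p.1 + t * (p.2 - p.1)) (φ * (p.2 - p.1))} :=
    measurableSet_arc (by fun_prop) measurable_const
  rw [measureReal_def, measureReal_def, ← h.measure_preimage hm.nullMeasurableSet]
  rfl

/-- In expectation, and with respect to every density, agent `i` receives the fraction `φ` of the
value of his bundle. -/
theorem integral_value_arcs {φ : ℝ} (hφ0 : 0 ≤ φ) (hφ1 : φ ≤ 1) (g : Density) :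
    ∫ θ, g.value (R.arcs φ f i θ) ∂(Measure.pi fun _ => volume : Measure (R.Starts f)) =
      φ * g.value (R.alloc f i) := by
  have hm : MeasurableSet (R.alloc f i) := ((R.alloc_isMNW f).1.1 i).measurableSet
  rw [integral_value _ g _ (R.measurableSet_mem_arcs f i φ), Density.value,
    ← integral_indicator hm, ← integral_const_mul]
  refine integral_congr_ae ?_
  have hae : ∀ᵐ x : ℝ, x ∉ ((R.pieces f i).image Prod.fst ∪ (R.pieces f i).image Prod.snd :
      Finset ℝ) :=
    measure_eq_zero_iff_ae_notMem.1 ((Finset.finite_toSet _).measure_zero volume)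
  filter_upwards [hae] with x hx
  by_cases hxA : x ∈ R.alloc f i
  · rw [indicator_of_mem hxA]
    obtain ⟨p, hp, hxp⟩ := mem_iUnion₂.1 hxA
    have hx' : x ∈ Ioo p.1 p.2 := by
      refine ⟨lt_of_le_of_ne hxp.1 fun h => hx ?_, lt_of_le_of_ne hxp.2 fun h => hx ?_⟩
      · exact Finset.mem_union_left _ (Finset.mem_image.2 ⟨p, hp, h⟩)
      · exact Finset.mem_union_right _ (Finset.mem_image.2 ⟨p, hp, h.symm⟩)
    rw [R.prob_mem_arcs f i hφ0 hφ1 hp hx']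
  · have h : {θ | x ∈ R.arcs φ f i θ} = ∅ :=
      eq_empty_of_forall_notMem fun θ hθ => hxA (R.arcs_subset f i φ θ hθ)
    rw [indicator_of_notMem hxA, h]
    simp

/-- With respect to his reported density, agent `i` receives exactly the fraction `φ` of the value
of his bundle, for all starting points. -/
theorem value_arcs {φ : ℝ} (hφ0 : 0 ≤ φ) (hφ1 : φ ≤ 1) (θ : R.Starts f) :
    (f i).value (R.arcs φ f i θ) = φ * (f i).value (R.alloc f i) := by
  have hU : ∀ p : {p : ℝ × ℝ // p ∈ R.pieces f i},
      R.arcs φ f i θ ∩ Ioo p.1.1 p.1.2 = arc p.1.1 p.1.2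
        (p.1.1 + (θ ⟨i, p⟩ : ℝ) * (p.1.2 - p.1.1)) (φ * (p.1.2 - p.1.1)) ∩ Ioo p.1.1 p.1.2 := by
    rintro ⟨p, hp⟩
    ext x
    simp only [mem_inter_iff]
    exact and_congr_left fun hx => R.mem_arcs_iff f i φ hp hx θ
  have hbm := (R.isBundle_arcs f i φ θ).measurableSet
  have hd : ∀ p ∈ R.pieces f i, ∀ q ∈ R.pieces f i, p ≠ q →
      Disjoint (Ioo p.1 p.2) (Ioo q.1 q.2) := R.piece_disjoint f i
  -- Up to a null set, the arcs are cut into their intersections with the open pieces.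
  have h1 : (R.alloc f i : Set ℝ) =ᵐ[volume] (⋃ p ∈ R.pieces f i, Ioo p.1 p.2 : Set ℝ) :=
    Filter.EventuallyEq.countable_bUnion (Finset.countable_toSet _) fun p _ => Ioo_ae_eq_Icc.symm
  have h2 : (f i).value (R.arcs φ f i θ) =
      (f i).value (⋃ p ∈ R.pieces f i, R.arcs φ f i θ ∩ Ioo p.1 p.2) := by
    rw [← inter_iUnion₂]
    refine (f i).value_congr ?_
    conv_lhs => rw [← inter_eq_self_of_subset_left (R.arcs_subset f i φ θ)]
    exact (Filter.EventuallyEq.refl _ _).inter h1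
  have h3 := integral_biUnion_finset (μ := volume) (f := (f i).toFun) (R.pieces f i)
    (s := fun p => R.arcs φ f i θ ∩ Ioo p.1 p.2) (fun _ _ => hbm.inter measurableSet_Ioo)
    (fun p hp q hq hpq => (hd p hp q hq hpq).mono inter_subset_right inter_subset_right)
    fun _ _ => (f i).integrable.integrableOn
  rw [h2, MNWRule.alloc, (f i).value_biUnion_Icc _ _ _ hd, Finset.mul_sum]
  refine h3.trans (Finset.sum_congr rfl fun p hp => ?_)
  have hlt := (R.piece_mem f i p hp).2.1
  have hc : ∀ x ∈ Ioo p.1 p.2, (f i).toFun x = (f i).toFun ((p.1 + p.2) / 2) := fun x hx =>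
    R.piece_const f i p hp i x hx _ ⟨by linarith, by linarith⟩
  have hs := start_mem hlt (θ ⟨i, ⟨p, hp⟩⟩)
  have hvol : volume.real (R.arcs φ f i θ ∩ Ioo p.1 p.2) = φ * (p.2 - p.1) := by
    rw [hU ⟨p, hp⟩]
    refine (measureReal_congr ?_).trans (volume_arc hs (mul_nonneg hφ0 (sub_pos.2 hlt).le)
      (mul_le_of_le_one_left (sub_pos.2 hlt).le hφ1))
    refine ((Filter.EventuallyEq.refl _ _).inter Ioo_ae_eq_Icc).trans ?_
    rw [inter_eq_self_of_subset_left (arc_subset hs)]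
    exact Filter.EventuallyEq.rfl
  have h4 := (f i).value_inter_Ioo hbm hc
  rw [Density.value] at h4
  rw [h4, hvol, (f i).value_Icc hlt.le hc]
  ring

variable {f i}

/-- The mechanism in which agent `i` keeps, instead of the fraction of the Partial Allocation
mechanism, an arbitrary fraction `φ f i` of each of his pieces.  For `φ = R.fraction c` this is
`R.randomizedPA c` by definition. -/
def arcMechanism (φ : ∀ {n : ℕ}, (Fin n → Density) → Fin n → ℝ) : Mechanism where
  Ω _ f := R.Starts f
  mΩ _ _ := inferInstance
  μ _ _ := Measure.pi fun _ => volume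
  prob _ _ := inferInstance
  outcome _ f θ i := R.arcs (φ f i) f i θ
  isAllocation _ f θ := ⟨fun i => R.isBundle_arcs f i _ θ, fun i j hij =>
    measure_mono_null (inter_subset_inter (R.arcs_subset f i _ θ) (R.arcs_subset f j _ θ))
      ((R.isMNW f).1.2 i j hij)⟩
  measurable_value _ f i g :=
    measurable_value_of_measurableSet g _ (R.measurableSet_mem_arcs f i _)

variable {φ : ∀ {n : ℕ}, (Fin n → Density) → Fin n → ℝ}

theorem expectedValue_arcMechanism (hφ0 : 0 ≤ φ f i) (hφ1 : φ f i ≤ 1) (g : Density) :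
    (R.arcMechanism φ).expectedValue f i g = φ f i * g.value (R.alloc f i) :=
  R.integral_value_arcs f i hφ0 hφ1 g

theorem isApproxMNW_arcMechanism {α : ℝ} (hα : 0 ≤ α)
    (hφ : ∀ {n : ℕ} (f : Fin n → Density) (i : Fin n), φ f i ∈ Icc α 1) :
    (R.arcMechanism φ).IsApproxMNW α := by
  refine fun n f => Filter.Eventually.of_forall fun θ => ⟨R.alloc f, R.alloc_isMNW f, fun i => ?_⟩
  have h := R.value_arcs f i (hα.trans (hφ f i).1) (hφ f i).2 θ
  refine (mul_le_mul_of_nonneg_right (hφ f i).1 ((f i).value_nonneg _)).trans_eq ?_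
  exact h.symm

theorem isDeterministic_arcMechanism
    (hφ : ∀ {n : ℕ} (f : Fin n → Density) (i : Fin n), φ f i = 1) :
    (R.arcMechanism φ).IsDeterministic :=
  fun _ f => ⟨R.alloc f, Filter.Eventually.of_forall fun θ => funext fun i => by
    have h : R.arcs (φ f i) f i θ = R.alloc f i := by rw [hφ]; exact R.arcs_one f i θ
    exact h⟩

/-- A deterministic outcome either almost surely contains a given interior point of a piece, or
almost surely does not contain it, whereas the probability of this event is `φ f i`. -/
theorem not_isDeterministic_arcMechanism (h0 : 0 < φ f i) (h1 : φ f i < 1) :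
    ¬ (R.arcMechanism φ).IsDeterministic := by
  intro hdet
  obtain ⟨A, hA⟩ := hdet n f
  have hA' : ∀ᵐ θ ∂(Measure.pi fun _ => volume : Measure (R.Starts f)),
      R.arcs (φ f i) f i θ = A i := by
    filter_upwards [hA] with θ hθ
    exact congrFun hθ i
  obtain ⟨p, hp⟩ : (R.pieces f i).Nonempty := by
    by_contra h
    have hpos := R.value_alloc_pos f i
    rw [MNWRule.alloc, Finset.not_nonempty_iff_eq_empty.1 h] at hpos
    simp [Density.value] at hpos
  have hlt := (R.piece_mem f i p hp).2.1
  have hprob := R.prob_mem_arcs f i h0.le h1.le hp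
    (x := (p.1 + p.2) / 2) ⟨by linarith, by linarith⟩
  by_cases hx : (p.1 + p.2) / 2 ∈ A i
  · have : ({θ | (p.1 + p.2) / 2 ∈ R.arcs (φ f i) f i θ} : Set (R.Starts f)) =ᵐ[
        Measure.pi fun _ => volume] univ := by
      filter_upwards [hA'] with θ hθ
      refine propext ?_
      change (p.1 + p.2) / 2 ∈ R.arcs (φ f i) f i θ ↔ True
      simpa [hθ] using hx
    rw [measureReal_congr this, probReal_univ] at hprob
    exact h1.ne hprob.symm
  · have : ({θ | (p.1 + p.2) / 2 ∈ R.arcs (φ f i) f i θ} : Set (R.Starts f)) =ᵐ[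
        Measure.pi fun _ => volume] (∅ : Set (R.Starts f)) := by
      filter_upwards [hA'] with θ hθ
      refine propext ?_
      change (p.1 + p.2) / 2 ∈ R.arcs (φ f i) f i θ ↔ False
      simpa [hθ] using hx
    rw [measureReal_congr this, measureReal_empty] at hprob
    exact h0.ne hprob

end MNWRule

/-! ### Profiles in which a misreport almost doubles the value -/

/-- The density that is constant on both halves of the cake and gives them the values `a`
and `b`. -/
def halvesDensity (a b : ℝ) (ha : 0 ≤ a) (hb : 0 ≤ b) (hab : 0 < a + b) : Density where
  toFun x := (Icc (0 : ℝ) (1 / 2)).indicator (fun _ => 2 * a) x +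
    (Ioc (1 / 2 : ℝ) 1).indicator (fun _ => 2 * b) x
  nonneg x := add_nonneg (indicator_nonneg (fun _ _ => by positivity) x)
    (indicator_nonneg (fun _ _ => by positivity) x)
  zero_off x hx := by
    rw [indicator_of_notMem fun h => hx ⟨h.1, h.2.trans (by norm_num)⟩,
      indicator_of_notMem fun h => hx ⟨by linarith [h.1], h.2⟩, add_zero]
  piecewise_const := by
    refine ⟨{0, 1 / 2, 1}, fun x y hxy h => ?_⟩
    have hnot : ∀ b ∈ ({0, 1 / 2, 1} : Finset ℝ), b < x ∨ y < b := fun b hb => by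
      by_contra! hcon
      exact h b hb hcon
    have h0 := hnot 0 (by simp)
    have h1 := hnot (1 / 2) (by simp)
    have h2 := hnot 1 (by simp)
    have e1 : x ∈ Icc (0 : ℝ) (1 / 2) ↔ y ∈ Icc (0 : ℝ) (1 / 2) := by
      constructor <;> rintro ⟨k1, k2⟩ <;> constructor <;>
        rcases h0 with h0 | h0 <;> rcases h1 with h1 | h1 <;> linarith
    have e2 : x ∈ Ioc (1 / 2 : ℝ) 1 ↔ y ∈ Ioc (1 / 2 : ℝ) 1 := by
      constructor <;> rintro ⟨k1, k2⟩ <;> constructor <;>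
        rcases h1 with h1 | h1 <;> rcases h2 with h2 | h2 <;> linarith
    simp only [indicator, e1, e2]
  pos := by
    rw [integral_add, setIntegral_indicator measurableSet_Icc,
      setIntegral_indicator measurableSet_Ioc, setIntegral_const, setIntegral_const,
      inter_eq_self_of_subset_right (Icc_subset_Icc_right (by norm_num)),
      inter_eq_self_of_subset_right (Ioc_subset_Icc_self.trans
        (Icc_subset_Icc_left (by norm_num))),
      Real.volume_real_Icc_of_le (by norm_num), Real.volume_real_Ioc_of_le (by norm_num)]
    · simp only [smul_eq_mul]
      linarith
    · exact (integrable_const _).indicator measurableSet_Icc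
    · exact (integrable_const _).indicator measurableSet_Ioc

/-- The grid with the two halves of the cake as cells; `false` is the left half. -/
def halvesGrid : Grid Bool where
  left k := if k then 1 / 2 else 0
  right k := if k then 1 else 1 / 2
  left_nonneg k := by split_ifs <;> norm_num
  lt k := by split_ifs <;> norm_num
  right_le_one k := by split_ifs <;> norm_num
  disjoint k l hkl := by
    refine Set.disjoint_left.2 fun x hx hx' => ?_
    cases k <;> cases l <;> simp at hkl hx hx' <;> linarith [hx.1, hx.2, hx'.1, hx'.2]
  cover := by
    have hae : ∀ᵐ x : ℝ, x ∉ ({0, 1 / 2, 1} : Set ℝ) :=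
      measure_eq_zero_iff_ae_notMem.1 ((Set.toFinite _).measure_zero volume)
    filter_upwards [hae] with x hx hx01
    simp only [mem_insert_iff, mem_singleton_iff, not_or] at hx
    rcases lt_or_gt_of_ne hx.2.1 with h | h
    · exact ⟨false, by simpa using ⟨lt_of_le_of_ne hx01.1 (Ne.symm hx.1), by simpa using h⟩⟩
    · exact ⟨true, by simpa using ⟨by simpa using h, lt_of_le_of_ne hx01.2 hx.2.2⟩⟩

section

variable {a b : ℝ} (ha : 0 ≤ a) (hb : 0 ≤ b) (hab : 0 < a + b)

theorem halvesDensity_left {x : ℝ} (hx : x ∈ Ioo (0 : ℝ) (1 / 2)) :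
    (halvesDensity a b ha hb hab).toFun x = 2 * a := by
  have h1 : x ∈ Icc (0 : ℝ) (1 / 2) := Ioo_subset_Icc_self hx
  have h2 : x ∉ Ioc (1 / 2 : ℝ) 1 := fun h => lt_asymm h.1 hx.2
  simp only [halvesDensity]
  rw [indicator_of_mem h1, indicator_of_notMem h2, add_zero]

theorem halvesDensity_right {x : ℝ} (hx : x ∈ Ioo (1 / 2 : ℝ) 1) :
    (halvesDensity a b ha hb hab).toFun x = 2 * b := by
  have h1 : x ∉ Icc (0 : ℝ) (1 / 2) := fun h => absurd hx.1 (not_lt.2 h.2)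
  have h2 : x ∈ Ioc (1 / 2 : ℝ) 1 := Ioo_subset_Ioc_self hx
  simp only [halvesDensity]
  rw [indicator_of_notMem h1, indicator_of_mem h2, zero_add]

theorem halvesGrid_adapted : halvesGrid.Adapted (halvesDensity a b ha hb hab) := by
  intro k x hx y hy
  cases k
  · simp only [halvesGrid, Bool.false_eq_true, if_false] at hx hy
    rw [halvesDensity_left ha hb hab hx, halvesDensity_left ha hb hab hy]
  · simp only [halvesGrid, if_true] at hx hy
    rw [halvesDensity_right ha hb hab hx, halvesDensity_right ha hb hab hy]

theorem halvesGrid_weight (k : Bool) :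
    halvesGrid.weight (halvesDensity a b ha hb hab) k = if k then b else a := by
  cases k
  · simp only [halvesGrid, Grid.weight, Bool.false_eq_true, if_false]
    rw [Density.value_Icc _ (by norm_num) fun x hx => halvesDensity_left ha hb hab hx]
    ring
  · simp only [halvesGrid, Grid.weight, if_true]
    rw [Density.value_Icc _ (by norm_num) fun x hx => halvesDensity_right ha hb hab hx]
    ring

end

/-- A market in which all agents value the good `false` at `1`, and only agent `i` values the good
`true`.  He gets all of it, and his utility is at least the fraction `1 / card ι` of his total
value, with equality if he also gets a part of the other good. -/
theorem IsOptimal.two_goods {ι : Type} [Fintype ι] {u x : ι → Bool → ℝ} (hx : IsOptimal u x)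
    (hpos : ∀ j, 0 < utility (u j) (x j)) {i : ι} {β : ℝ} (hβ : 0 < β)
    (hfalse : ∀ j, u j false = 1) (htrue : u i true = β) (hne : ∀ j, j ≠ i → u j true = 0) :
    x i true = 1 ∧ 1 + β ≤ Fintype.card ι * (x i false + β) ∧
      (x i false ≠ 0 → 1 + β = Fintype.card ι * (x i false + β)) := by
  have : Nonempty ι := ⟨i⟩
  have hu : ∀ j k, 0 ≤ u j k := by
    intro j k
    cases k
    · rw [hfalse]; exact zero_le_one
    · rcases eq_or_ne j i with rfl | h
      · rw [htrue]; exact hβ.le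
      · rw [hne j h]
  obtain ⟨p, hp⟩ := hx.exists_price hu hpos
  have hsum := hp.sum_eq_card
  rw [Fintype.sum_bool] at hsum
  have hpt : 0 < p true := (div_pos (htrue ▸ hβ) (hpos i)).trans_le (hp.le i true)
  have hshare : x i true = 1 := by
    rw [← hp.cleared true hpt.ne', Finset.sum_eq_single i]
    · intro j _ hj
      by_contra hjt
      have := hp.eq_of_share j true hjt
      rw [hne j hj, zero_div] at this
      exact hpt.ne' this
    · simp
  have hV : utility (u i) (x i) = x i false + β := by
    rw [utility, Fintype.sum_bool, hshare, htrue, hfalse]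
    ring
  have hVpos := hpos i
  have h1 := hp.eq_of_share i true (by rw [hshare]; exact one_ne_zero)
  have h2 := hp.le i false
  rw [hfalse, hV] at h2
  rw [htrue, hV] at h1
  rw [hV] at hVpos
  refine ⟨hshare, ?_, fun h0 => ?_⟩
  · rw [← hsum, h1, add_mul, div_mul_cancel₀ _ hVpos.ne']
    have := (div_le_iff₀ hVpos).1 h2
    linarith
  · have h3 := hp.eq_of_share i false h0
    rw [hfalse, hV] at h3
    rw [← hsum, h1, h3, add_mul, div_mul_cancel₀ _ hVpos.ne', div_mul_cancel₀ _ hVpos.ne', add_comm]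

/-- The factor `2` in `IsMNW.value_le_two_mul` is sharp.  All of the `m + 1` agents value the left
half of the cake at `1`, and only agent `0` values the right half, at `1 / m`.  With these values he
gets no part of the left half.  If he reports the much smaller value `1 / m ^ 2` of the right
half, then he still gets all of it, and almost the fraction `1 / m` of the left half as well. -/
theorem exists_lt_value {b : ℝ} (hb : b < 2) : ∃ (m : ℕ) (f : Fin (m + 1) → Density) (g : Density),
    ∀ A B : Fin (m + 1) → Set ℝ, IsMNW f A → IsMNW (Function.update f 0 g) B →
      b * (f 0).value (A 0) < (f 0).value (B 0) := by
  wlog hb0 : 0 ≤ b generalizing b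
  · obtain ⟨m, f, g, h⟩ := this (b := 0) two_pos le_rfl
    exact ⟨m, f, g, fun A B hA hB => (mul_le_mul_of_nonneg_right (not_le.1 hb0).le
      ((f 0).value_nonneg _)).trans_lt (h A B hA hB)⟩
  obtain ⟨k, hk⟩ := exists_nat_gt (2 / (2 - b))
  set m := k + 1 with hm
  have hmpos : (0 : ℝ) < m := by positivity
  have hmb : 2 < (2 - b) * (m + 1) := by
    rw [div_lt_iff₀ (by linarith)] at hk
    have : (k : ℝ) ≤ m + 1 := by rw [hm]; push_cast; linarith
    nlinarith
  have hd : ∀ β : ℝ, 0 ≤ β → 0 < 1 + β := fun β h => by linarith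
  set d : ∀ β : ℝ, 0 ≤ β → Density := fun β h => halvesDensity 1 β zero_le_one h (hd β h) with hdd
  have hβ : (0 : ℝ) < 1 / m := by positivity
  have hδ : (0 : ℝ) < 1 / (m : ℝ) ^ 2 := by positivity
  set f : Fin (m + 1) → Density := fun j => if j = 0 then d (1 / m) hβ.le else d 0 le_rfl with hf
  have had : ∀ β h, halvesGrid.Adapted (d β h) := fun β h => halvesGrid_adapted _ _ _
  have hw : ∀ β h k, halvesGrid.weight (d β h) k = if k then β else 1 := fun β h k =>
    halvesGrid_weight _ _ _ k
  -- This is `IsOptimal.two_goods` when agent `0` reports the value `β` of the right half.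
  have key : ∀ (β : ℝ) (h : 0 < β) (A : Fin (m + 1) → Set ℝ),
      IsMNW (Function.update f 0 (d β h.le)) A →
      halvesGrid.share (A 0) true = 1 ∧
      1 + β ≤ (m + 1) * (halvesGrid.share (A 0) false + β) ∧
      (halvesGrid.share (A 0) false ≠ 0 →
        1 + β = (m + 1) * (halvesGrid.share (A 0) false + β)) := by
    intro β h A hA
    have hupd : ∀ j, Function.update f 0 (d β h.le) j = if j = 0 then d β h.le else d 0 le_rfl := by
      intro j
      rcases eq_or_ne j 0 with rfl | hj
      · simp
      · simp [hf, hj]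
    have hG : ∀ j, halvesGrid.Adapted (Function.update f 0 (d β h.le) j) := by
      intro j
      rw [hupd]
      split_ifs <;> exact had _ _
    have hopt := (hA.isOptimal hG).two_goods (i := 0) (β := β)
      (fun j => by rw [← (hG j).value_eq (hA.1.1 j).measurableSet]; exact hA.value_pos j) h
      (fun j => by rw [hupd]; split_ifs <;> simp [hw]) (by simp [hw])
      (fun j hj => by rw [hupd, if_neg hj, hw]; simp)
    simpa using hopt
  have hf0 : f 0 = d (1 / m) hβ.le := by simp [hf]
  have hval : ∀ S : Set ℝ, MeasurableSet S →
      (f 0).value S = halvesGrid.share S false + halvesGrid.share S true * (1 / m) := by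
    intro S hS
    rw [hf0, (had _ _).value_eq hS, utility, Fintype.sum_bool, hw, hw]
    simp [add_comm]
  refine ⟨m, f, d (1 / (m : ℝ) ^ 2) hδ.le, fun A B hA hB => ?_⟩
  obtain ⟨hA1, -, hA2⟩ := key (1 / m) hβ A (by rwa [← hf0, Function.update_eq_self])
  obtain ⟨hB1, hB2, -⟩ := key _ hδ B hB
  rw [hval _ (hA.1.1 0).measurableSet, hval _ (hB.1.1 0).measurableSet, hA1, hB1]
  have hA0 : halvesGrid.share (A 0) false = 0 := by
    by_contra h0
    have h1 := hA2 h0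
    have h2 : ((m : ℝ) + 1) * (1 / m) = 1 + 1 / m := by field_simp
    rw [mul_add, h2] at h1
    have h3 : ((m : ℝ) + 1) * halvesGrid.share (A 0) false = 0 := by linarith
    exact h0 ((mul_eq_zero.1 h3).resolve_left (by positivity))
  rw [hA0]
  set z := halvesGrid.share (B 0) false
  have hz : ((m : ℝ) - 1) / m ≤ (m + 1) * z := by
    have h2 : 1 + 1 / (m : ℝ) ^ 2 - (m + 1) * (1 / (m : ℝ) ^ 2) = ((m : ℝ) - 1) / m := by
      field_simp
      ring
    linarith
  rw [div_le_iff₀ hmpos] at hz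
  have h4 : b * (0 + 1 * (1 / (m : ℝ))) = b / m := by ring
  have h5 : z + 1 * (1 / (m : ℝ)) = (z * m + 1) / m := by field_simp
  rw [h4, h5]
  refine div_lt_div_of_pos_right ?_ hmpos
  have h6 : b * (m + 1) < (z * m + 1) * (m + 1) := by nlinarith
  exact lt_of_mul_lt_mul_right h6 (by positivity)

/-! ### Nontrivial fractions -/

theorem IsAllocation.sum_value_le {ι : Type} [Fintype ι] {A : ι → Set ℝ} (hA : IsAllocation A)
    (d : Density) : ∑ j, d.value (A j) ≤ d.value (Icc 0 1) := by
  obtain ⟨κ, _, G, hG⟩ := exists_grid fun _ : Unit => d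
  rw [← (hG ()).sum_weight]
  simp only [(hG ()).value_eq (hA.1 _).measurableSet, utility]
  rw [Finset.sum_comm]
  refine Finset.sum_le_sum fun k _ => ?_
  rw [← Finset.sum_mul]
  exact mul_le_of_le_one_left (G.weight_nonneg d k) ((G.isAssignment_share hA).2 k)

/-- If two agents report the same density, then each of them would get more without the other. -/
theorem MNWRule.fraction_lt_one (R : MNWRule) {c : ℝ} (hc : 0 < c) (d : Density) :
    R.fraction c (fun _ : Fin 2 => d) 0 < 1 := by
  set f : Fin 2 → Density := fun _ => d with hf
  rw [fraction_eq_rpow]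
  refine Real.rpow_lt_one (R.fraction_one_pos f 0).le ?_ hc
  rw [fraction_one, div_lt_one (R.prod_absent_pos f 0)]
  have hsub : Subsingleton {j : Fin 2 // j ≠ 0} :=
    ⟨fun a b => Subtype.ext
      ((Fin.eq_one_of_ne_zero _ a.2).trans (Fin.eq_one_of_ne_zero _ b.2).symm)⟩
  have hunit : IsBundle (Icc 0 1) := ⟨{(0, 1)}, by simp, by simp⟩
  have h1 := (isMNW_iff.1 (R.absent_isMNW f 0)).2 (fun _ => Icc 0 1)
    ⟨fun _ => hunit, fun i j hij => (hij (Subsingleton.elim i j)).elim⟩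
  refine lt_of_lt_of_le ?_ h1
  rw [Fintype.prod_subsingleton _ (⟨1, by simp⟩ : {j : Fin 2 // j ≠ 0}),
    Fintype.prod_subsingleton _ (⟨1, by simp⟩ : {j : Fin 2 // j ≠ 0})]
  have h2 := (R.alloc_isMNW f).1.sum_value_le d
  rw [Fin.sum_univ_two] at h2
  have h3 := R.value_alloc_pos f 0
  simp only [hf] at h3 ⊢
  linarith

/-! ### Incentive ratios -/

namespace MNWRule

variable (R : MNWRule) {φ : ∀ {n : ℕ}, (Fin n → Density) → Fin n → ℝ}

theorem incentiveRatio_arcMechanism_le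
    (hφ : ∀ {n : ℕ} (f : Fin n → Density) (i : Fin n), φ f i ∈ Icc (0 : ℝ) 1) {K : ℝ} (hK : 0 ≤ K)
    (h : ∀ {n : ℕ} (f : Fin n → Density) (i : Fin n) (g : Density),
      φ (Function.update f i g) i * (f i).value (R.alloc (Function.update f i g) i) ≤
        K * (φ f i * (f i).value (R.alloc f i))) :
    (R.arcMechanism φ).incentiveRatio ≤ ENNReal.ofReal K := by
  refine iSup_le fun n => iSup_le fun f => iSup_le fun i => iSup_le fun g => ?_
  rw [R.expectedValue_arcMechanism (hφ f i).1 (hφ f i).2,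
    R.expectedValue_arcMechanism (hφ _ i).1 (hφ _ i).2]
  refine ENNReal.div_le_of_le_mul ?_
  rw [← ENNReal.ofReal_mul hK]
  exact ENNReal.ofReal_le_ofReal (h f i g)

theorem le_incentiveRatio_arcMechanism
    (hφ : ∀ {n : ℕ} (f : Fin n → Density) (i : Fin n), φ f i ∈ Ioc (0 : ℝ) 1) {K : ℝ}
    (h : ∀ b < K, ∃ (n : ℕ) (f : Fin n → Density) (i : Fin n) (g : Density),
      b * (φ f i * (f i).value (R.alloc f i)) ≤
        φ (Function.update f i g) i * (f i).value (R.alloc (Function.update f i g) i)) :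
    ENNReal.ofReal K ≤ (R.arcMechanism φ).incentiveRatio := by
  by_contra! hlt
  set ρ := (R.arcMechanism φ).incentiveRatio with hρ
  have htop : ρ ≠ ⊤ := hlt.ne_top
  have hK : ρ.toReal < K := (ENNReal.lt_ofReal_iff_toReal_lt htop).1 hlt
  obtain ⟨b, hb1, hb2⟩ := exists_between hK
  obtain ⟨n, f, i, g, hfg⟩ := h b hb2
  have hb0 : 0 ≤ b := ENNReal.toReal_nonneg.trans hb1.le
  have hle : ENNReal.ofReal b ≤ ρ := by
    have hpos : 0 < φ f i * (f i).value (R.alloc f i) :=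
      mul_pos (hφ f i).1 (R.value_alloc_pos f i)
    refine le_trans ?_
      (le_iSup_of_le n (le_iSup_of_le f (le_iSup_of_le i (le_iSup_of_le g le_rfl))))
    rw [R.expectedValue_arcMechanism (hφ f i).1.le (hφ f i).2,
      R.expectedValue_arcMechanism (hφ _ i).1.le (hφ _ i).2,
      ENNReal.le_div_iff_mul_le (Or.inl (ENNReal.ofReal_pos.2 hpos).ne')
        (Or.inl ENNReal.ofReal_ne_top), ← ENNReal.ofReal_mul hb0]
    exact ENNReal.ofReal_le_ofReal hfg
  exact absurd ((ENNReal.ofReal_le_iff_le_toReal htop).1 hle) (not_le.2 hb1)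

theorem fraction_mem_Icc {c : ℝ} (hc : c ∈ Icc (0 : ℝ) 1) {n : ℕ} (f : Fin n → Density)
    (i : Fin n) : R.fraction c f i ∈ Icc (Real.exp (-c)) 1 :=
  ⟨R.exp_neg_le_fraction f i hc.1, R.fraction_le_one f i hc.1⟩

theorem incentiveRatio_randomizedPA_le {c : ℝ} (hc : c ∈ Icc (0 : ℝ) 1) :
    (R.randomizedPA c).incentiveRatio ≤ ENNReal.ofReal (2 ^ (1 - c)) :=
  R.incentiveRatio_arcMechanism_le
    (fun f i => ⟨(R.fraction_pos f i c).le, R.fraction_le_one f i hc.1⟩) (by positivity)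
    fun f i g => R.fraction_mul_value_le f i hc g

theorem isApproxMNW_randomizedPA {c : ℝ} (hc : c ∈ Icc (0 : ℝ) 1) :
    (R.randomizedPA c).IsApproxMNW (Real.exp (-c)) :=
  R.isApproxMNW_arcMechanism (Real.exp_pos _).le fun f i => R.fraction_mem_Icc hc f i

theorem incentiveRatio_randomizedPA_zero :
    (R.randomizedPA 0).incentiveRatio = ENNReal.ofReal (2 ^ (1 - 0 : ℝ)) := by
  have hone : ∀ {n : ℕ} (f : Fin n → Density) (i : Fin n), R.fraction 0 f i = 1 := fun f i =>
    Real.rpow_zero _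
  refine le_antisymm (R.incentiveRatio_randomizedPA_le (by simp)) ?_
  refine R.le_incentiveRatio_arcMechanism (fun f i => by simp [hone]) fun b hb => ?_
  rw [sub_zero, Real.rpow_one] at hb
  obtain ⟨m, f, g, h⟩ := exists_lt_value hb
  refine ⟨m + 1, f, 0, g, ?_⟩
  simp only [hone, one_mul]
  exact (h _ _ (R.alloc_isMNW f) (R.alloc_isMNW _)).le

theorem incentiveRatio_randomizedPA_one :
    (R.randomizedPA 1).incentiveRatio = ENNReal.ofReal (2 ^ (1 - 1 : ℝ)) := by
  refine le_antisymm (R.incentiveRatio_randomizedPA_le (by simp)) ?_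
  refine R.le_incentiveRatio_arcMechanism
    (fun f i => ⟨R.fraction_pos f i 1, R.fraction_le_one f i zero_le_one⟩) fun b hb => ?_
  rw [sub_self, Real.rpow_zero] at hb
  set d := halvesDensity 1 1 zero_le_one zero_le_one (by norm_num)
  refine ⟨1, fun _ => d, 0, d, ?_⟩
  have hupd : Function.update (fun _ : Fin 1 => d) 0 d = fun _ => d :=
    Function.update_eq_self 0 fun _ : Fin 1 => d
  rw [hupd]
  exact mul_le_of_le_one_left (mul_nonneg (R.fraction_pos _ 0 1).le (d.value_nonneg _)) hb.le

theorem isDeterministic_randomizedPA_iff {c : ℝ} (hc : 0 ≤ c) :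
    (R.randomizedPA c).IsDeterministic ↔ c = 0 := by
  refine ⟨fun h => ?_, ?_⟩
  · by_contra hne
    exact R.not_isDeterministic_arcMechanism (R.fraction_pos _ 0 c)
      (R.fraction_lt_one (lt_of_le_of_ne hc (Ne.symm hne))
        (halvesDensity 1 1 zero_le_one zero_le_one (by norm_num))) h
  · rintro rfl
    exact R.isDeterministic_arcMechanism fun f i => Real.rpow_zero _

end MNWRule

/-- For a positive exponent, the fraction of a single agent in a single profile of the Partial
Allocation mechanism can be lowered so that the incentive ratio becomes exactly `2 ^ (1 - c)`.  The
profile is one in which the agent can gain more than the factor `2 ^ (1 - c)` in the underlying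
maximum Nash welfare allocation; since all fractions are at least `exp (-c)`, the lowered fraction
is still at least `exp (-c)`.  Lowering it makes misreports only less attractive in all other
profiles. -/
theorem exists_mechanism_of_pos {c : ℝ} (hc : c ∈ Icc (0 : ℝ) 1) (hc0 : 0 < c) :
    ∃ M : Mechanism, M.incentiveRatio = ENNReal.ofReal (2 ^ (1 - c)) ∧
      M.IsApproxMNW (Real.exp (-c)) ∧ ¬ M.IsDeterministic := by
  classical
  obtain ⟨R⟩ := nonempty_MNWRule
  set K : ℝ := 2 ^ (1 - c) with hK
  have hK1 : 1 ≤ K := Real.one_le_rpow one_le_two (sub_nonneg.2 hc.2)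
  have hK0 : 0 < K := one_pos.trans_le hK1
  have hK2 : K < 2 := by
    calc K < 2 ^ (1 : ℝ) := Real.rpow_lt_rpow_of_exponent_lt one_lt_two (by linarith)
      _ = 2 := Real.rpow_one 2
  obtain ⟨m, f₀, g₀, hgain⟩ := exists_lt_value hK2
  have hgain₀ := hgain _ _ (R.alloc_isMNW f₀) (R.alloc_isMNW (Function.update f₀ 0 g₀))
  have hV := R.value_alloc_pos f₀ 0
  set V := (f₀ 0).value (R.alloc f₀ 0) with hVdef
  set S : Set ℝ := {s | ∃ g, Function.update f₀ 0 g ≠ f₀ ∧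
    s = R.fraction c (Function.update f₀ 0 g) 0 *
      (f₀ 0).value (R.alloc (Function.update f₀ 0 g) 0)} with hS
  have hub : ∀ s ∈ S, s ≤ K * (R.fraction c f₀ 0 * V) := by
    rintro s ⟨g, -, rfl⟩
    exact R.fraction_mul_value_le f₀ 0 hc g
  have hbdd : BddAbove S := ⟨_, hub⟩
  have hmem : R.fraction c (Function.update f₀ 0 g₀) 0 *
      (f₀ 0).value (R.alloc (Function.update f₀ 0 g₀) 0) ∈ S := by
    refine ⟨g₀, fun heq => ?_, rfl⟩
    rw [heq] at hgain₀
    exact absurd hgain₀ (not_lt.2 (le_mul_of_one_le_left hV.le hK1))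
  -- With the fraction `t`, the best misreport gains exactly the factor `K`.
  set T := sSup S with hT
  set t := T / (K * V) with ht
  have hKV : 0 < K * V := mul_pos hK0 hV
  have htT : K * (t * V) = T := by
    rw [ht]
    field_simp
  have ht1 : t ≤ R.fraction c f₀ 0 := by
    rw [ht, div_le_iff₀ hKV]
    exact (csSup_le ⟨_, hmem⟩ hub).trans_eq (by ring)
  have ht0 : Real.exp (-c) ≤ t := by
    rw [ht, le_div_iff₀ hKV]
    refine le_trans ?_ (le_csSup hbdd hmem)
    exact mul_le_mul (R.fraction_mem_Icc hc _ _).1 hgain₀.le hKV.le (R.fraction_pos _ _ c).le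
  -- A dependent pair records the number of agents together with the profile.
  let ψ : ∀ {n : ℕ}, (Fin n → Density) → Fin n → ℝ := fun {n} f i =>
    if (⟨n, f, i⟩ : Σ n : ℕ, (Fin n → Density) × Fin n) = ⟨m + 1, f₀, 0⟩ then t
    else R.fraction c f i
  have hψ₀ : ψ f₀ 0 = t := if_pos rfl
  have hψne : ∀ {n : ℕ} (f : Fin n → Density) (i : Fin n),
      (⟨n, f, i⟩ : Σ n : ℕ, (Fin n → Density) × Fin n) ≠ ⟨m + 1, f₀, 0⟩ →
      ψ f i = R.fraction c f i := fun f i h => if_neg h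
  have hψ : ∀ {n : ℕ} (f : Fin n → Density) (i : Fin n),
      Real.exp (-c) ≤ ψ f i ∧ ψ f i ≤ R.fraction c f i := by
    intro n f i
    by_cases h : (⟨n, f, i⟩ : Σ n : ℕ, (Fin n → Density) × Fin n) = ⟨m + 1, f₀, 0⟩
    · cases h
      rw [hψ₀]
      exact ⟨ht0, ht1⟩
    · rw [hψne f i h]
      exact ⟨(R.fraction_mem_Icc hc f i).1, le_rfl⟩
  have hψIcc : ∀ {n : ℕ} (f : Fin n → Density) (i : Fin n), ψ f i ∈ Icc (Real.exp (-c)) 1 :=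
    fun f i => ⟨(hψ f i).1, (hψ f i).2.trans (R.fraction_le_one f i hc.1)⟩
  have hψpos : ∀ {n : ℕ} (f : Fin n → Density) (i : Fin n), 0 < ψ f i :=
    fun f i => (Real.exp_pos _).trans_le (hψ f i).1
  refine ⟨R.arcMechanism ψ, le_antisymm ?_ ?_,
    R.isApproxMNW_arcMechanism (Real.exp_pos _).le hψIcc, ?_⟩
  · refine R.incentiveRatio_arcMechanism_le (fun f i => ⟨(hψpos f i).le, (hψIcc f i).2⟩) hK0.le
      fun {n} f i g => ?_
    have hle := mul_le_mul_of_nonneg_right (hψ (Function.update f i g) i).2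
      ((f i).value_nonneg (R.alloc (Function.update f i g) i))
    by_cases h : (⟨n, f, i⟩ : Σ n : ℕ, (Fin n → Density) × Fin n) = ⟨m + 1, f₀, 0⟩
    · cases h
      by_cases hg : Function.update f₀ 0 g = f₀
      · rw [hg]
        exact le_mul_of_one_le_left (mul_nonneg (hψpos _ _).le hV.le) hK1
      · rw [hψ₀, htT]
        exact hle.trans (le_csSup hbdd ⟨g, hg, rfl⟩)
    · rw [hψne f i h]
      exact hle.trans (R.fraction_mul_value_le f i hc g)
  · refine R.le_incentiveRatio_arcMechanism (fun f i => ⟨hψpos f i, (hψIcc f i).2⟩) fun b hb => ?_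
    have hlt : b * (t * V) < T := by
      rw [← htT]
      exact mul_lt_mul_of_pos_right hb (mul_pos ((Real.exp_pos _).trans_le ht0) hV)
    obtain ⟨s, ⟨g, hg, rfl⟩, hs⟩ := exists_lt_of_lt_csSup ⟨_, hmem⟩ hlt
    refine ⟨m + 1, f₀, 0, g, ?_⟩
    rw [hψ₀, hψne (Function.update f₀ 0 g) 0 fun h =>
      hg (congrArg Prod.fst (eq_of_heq (Sigma.mk.inj h).2))]
    exact hs.le
  · set d := halvesDensity 1 1 zero_le_one zero_le_one (by norm_num)
    exact R.not_isDeterministic_arcMechanism (f := fun _ : Fin 2 => d) (i := 0) (hψpos _ _)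
      ((hψ _ _).2.trans_lt (R.fraction_lt_one hc0 d))

end Cake

end

theorem mainTheorem4 (c : ℝ) (hc : c ∈ Set.Icc (0 : ℝ) 1) :
    (∃ M : Cake.Mechanism,
      M.incentiveRatio = ENNReal.ofReal ((2 : ℝ) ^ (1 - c)) ∧
      M.IsApproxMNW (Real.exp (-c)) ∧
      (M.IsDeterministic ↔ c = 0)) ∧
    Nonempty Cake.MNWRule ∧
    ∀ R : Cake.MNWRule,
      (R.randomizedPA c).incentiveRatio ≤ ENNReal.ofReal ((2 : ℝ) ^ (1 - c)) ∧
      (c = 0 ∨ c = 1 →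
        (R.randomizedPA c).incentiveRatio = ENNReal.ofReal ((2 : ℝ) ^ (1 - c))) ∧
      (R.randomizedPA c).IsApproxMNW (Real.exp (-c)) ∧
      ((R.randomizedPA c).IsDeterministic ↔ c = 0) := by
  obtain ⟨R₀⟩ := Cake.nonempty_MNWRule
  refine ⟨?_, ⟨R₀⟩, fun R => ⟨R.incentiveRatio_randomizedPA_le hc, ?_,
    R.isApproxMNW_randomizedPA hc, R.isDeterministic_randomizedPA_iff hc.1⟩⟩
  · rcases hc.1.eq_or_lt with rfl | hc0
    · exact ⟨R₀.randomizedPA 0, R₀.incentiveRatio_randomizedPA_zero,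
        R₀.isApproxMNW_randomizedPA hc, R₀.isDeterministic_randomizedPA_iff le_rfl⟩
    · obtain ⟨M, h1, h2, h3⟩ := Cake.exists_mechanism_of_pos hc hc0
      exact ⟨M, h1, h2, iff_of_false h3 hc0.ne'⟩
  · rintro (rfl | rfl)
    · exact R.incentiveRatio_randomizedPA_zero
    · exact R.incentiveRatio_randomizedPA_one
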